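/- **Theorem.** For a finite simple graph $G=(V,E)$ let $\mathbf X_G=\sum_\kappa\prod_{v\in V}x_{\kappa(v)}$, the sum being over all proper colorings $\kappa:V\to\mathbb N$, be its chromatic symmetric function (over $\mathbb Q$). Let $\mathfrak{st}_k=\mathbf X_{\mathsf{St}_k}$, where $\mathsf{St}_k$ is the star graph on $k$ vertices (one central vertex joined to $k-1$ leaves), and put $\mathfrak{st}_\lambda=\mathfrak{st}_{\lambda_1}\cdots\mathfrak{st}_{\lambda_\ell}$ for a partition $\lambda=(\lambda_1,\dots,\lambda_\ell)$. Let $G$ be a connected unicyclic graph on $n$ vertices, i.e. a connected finite simple graph containing exactly one cycle, and let $c\ge 3$ be the size of this cycle. Let $k$ be the number of internal edges of $G$ (edges both of whose endpoints have degree at least two). Deleting the edges of the cycle leaves $c$ trees, each rooted at a vertex of the cycle; let $r$ be the number of these rooted trees that have more than one vertex. Then there are unique rational numbers $c_\lambda$ with $$\mathbf X_G=\sum_{\lambda\vdash n}c_\lambda\,\mathfrak{st}_\lambda ,$$ and for every hook partition $\lambda$ of $n$, with $m_1$ denoting the number of parts of $\lambda$ equal to $1$, $$c_\lambda=(-1)^{m_1}\left[(r-1)\binom{k-2}{m_1-1}+(c-1)\binom{k-2}{m_1}\right],$$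 where $\binom{a}{b}=0$ if $b<0$ or $b>a$. Here the hook partitions of $n$ are the partition $(1^n)$, for which $m_1=n$, and the partitions $(n-m_1,1^{m_1})$ with $0\le m_1\le n-2$. -/

import Mathlib

noncomputable section

/-- Only finitely many colourings contribute to a given monomial, so the count below is honest. -/
theorem SimpleGraph.finite_coloring_monomial {V : Type*} [Fintype V] (G : SimpleGraph V)
    (d : ℕ →₀ ℕ) : Finite {κ : G.Coloring ℕ // ∑ v, Finsupp.single (κ v) 1 = d} := by
  classical
  have hinj : Function.Injective
      (fun (κ : {κ : G.Coloring ℕ // ∑ v, Finsupp.single (κ v) 1 = d}) (v : V) =>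
        (⟨κ.1 v, by
          obtain ⟨κ, rfl⟩ := κ
          rw [Finsupp.mem_support_iff, Finsupp.finsetSum_apply]
          exact (Finset.sum_pos' (fun _ _ => Nat.zero_le _)
            ⟨v, Finset.mem_univ _, by simp⟩).ne'⟩ : d.support)) := by
    intro a b h
    ext v
    exact congrArg Subtype.val (congrFun h v)
  exact Finite.of_injective _ hinj

/-- The chromatic symmetric function `X_G = ∑_κ ∏_v x_{κ(v)}` of a finite simple graph `G`, the sum
being over all proper colourings `κ : V → ℕ`, as a formal power series over `ℚ` in the variables
`x_0, x_1, …`. It is given by its coefficients: the coefficient of the monomial `x^d` is the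
(finite) number of proper colourings `κ` with `∏_v x_{κ(v)} = x^d`. -/
def SimpleGraph.chromaticSymm {V : Type*} [Fintype V] (G : SimpleGraph V) : MvPowerSeries ℕ ℚ :=
  fun d => (Nat.card {κ : G.Coloring ℕ // ∑ v, Finsupp.single (κ v) 1 = d} : ℚ)

/-- `st_k = X_{St_k}`, where `St_k` is the star graph on `k ≥ 1` vertices
(the value at `k = 0` is the empty product and is never used). -/
def starSymm : ℕ → MvPowerSeries ℕ ℚ
  | 0 => 1
  | k + 1 => (SimpleGraph.starGraph (0 : Fin (k + 1))).chromaticSymm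

/-- `st_lam = st_{lam_1} st_{lam_2} ⋯ st_{lam_ℓ}` for a partition `lam` of `n`. -/
def starSymmPart {n : ℕ} (lam : n.Partition) : MvPowerSeries ℕ ℚ :=
  (lam.parts.map starSymm).prod

/-- A hook partition of `n`: a partition of the form `(n - m, 1^m)`, `m = 0` included. -/
def Nat.Partition.IsHook {n : ℕ} (lam : n.Partition) : Prop :=
  ∃ m : ℕ, lam.parts = (n - m) ::ₘ Multiset.replicate m 1

/-- A subgraph which is a cycle, i.e. a copy of the cycle graph on `m` vertices, `m ≥ 3`. -/
def SimpleGraph.Subgraph.IsCycleGraph {V : Type*} {G : SimpleGraph V} (C : G.Subgraph) : Prop :=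
  ∃ m : ℕ, 3 ≤ m ∧ Nonempty (C.coe ≃g SimpleGraph.cycleGraph m)

/-- `G` is unicyclic with cycle `C`: `C` is the one and only cycle contained in `G`. -/
def SimpleGraph.IsUnicyclicWith {V : Type*} (G : SimpleGraph V) (C : G.Subgraph) : Prop :=
  C.IsCycleGraph ∧ ∀ C' : G.Subgraph, C'.IsCycleGraph → C' = C

/-- The vertex set of the rooted tree attached to the cycle `C` at the vertex `v` of `C`: the
connected component of `v` after removal of the edges of `C`. -/
def SimpleGraph.Subgraph.rootedTree {V : Type*} {G : SimpleGraph V} (C : G.Subgraph) (v : V) :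
    Set V :=
  {w | (G.deleteEdges C.edgeSet).Reachable v w}

/-- The number of non-trivial rooted trees (those with more than one vertex) on the cycle `C`. -/
def SimpleGraph.Subgraph.numNontrivialTrees {V : Type*} {G : SimpleGraph V} (C : G.Subgraph) : ℕ :=
  {v | v ∈ C.verts ∧ (C.rootedTree v).Nontrivial}.ncard

/-- The internal edges of `G`: those both of whose endpoints have degree at least two. -/
def SimpleGraph.internalEdges {V : Type*} (G : SimpleGraph V) [G.LocallyFinite] : Set (Sym2 V) :=
  {e | e ∈ G.edgeSet ∧ ∀ v ∈ e, 2 ≤ G.degree v}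

/-- The binomial coefficient `C(a, b)` with the usual convention `C(a, b) = 0` for `b < 0`. -/
def binomZ (a : ℕ) (b : ℤ) : ℚ :=
  if 0 ≤ b then (a.choose b.toNat : ℚ) else 0

end

/-! Inclusion–exclusion over monochromatic edges gives `X_G = ∑_S (-1)^|S| ∏ p_{|K|}`, with `S`
running over sets of edges and `K` over the components of `(V, S)`. For a star this reads `st_{j+1}
= ∑_i (-1)^i C(j,i) p_{i+1} p_1^{j-i}`, a substitution that is its own inverse. Hence the `p_{j+1}`
are the same polynomials in the stars, and the stars inherit algebraic independence from the power
sums; this gives existence and uniqueness of the `c_λ`.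

To read off the coefficient of `st_{i+1} st_1^{n-i-1}`, put `st_1 = 1`, `st_{i+1} = ε` with `ε² =
0`, and every other star equal to `0`. Then `p_{j+1}` becomes `1 + (-1)^i C(j,i) ε`, the product
over components becomes a sum, and the coefficient is `(-1)^i ∑_S (-1)^|S| ∑_K C(|K|-1, i)`
(`star_expansion_hook`).

Now sum over `K` first. The signed count of those `S` having `K` as a component vanishes if an edge
avoids `K`. Otherwise `S` connects `K` and lies among the edges within `K`, whose number is `n -
∑_{v∉K} deg v`, since a unicyclic graph has `n` edges. Connecting `K` takes `|K|-1` edges, so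
`∑_{v∉K} (deg v - 1) ≤ 1`. Either only leaves are missing, with weight `(c-1)(-1)^(|K|-1)`, or
leaves and one cycle vertex of degree 2 are missing, with weight `(-1)^(|K|-1)`. There are `c - r`
such cycle vertices, and `k = n - #leaves`. The alternating sum over sets of leaves is an iterated
finite difference of a binomial coefficient (`sum_powerset_neg_one_pow_mul_choose`), and Pascal's
rule gives the stated form. -/

noncomputable section

open Finset MvPolynomial

/-! ### Power sums and inclusion–exclusion for colourings. -/

/-- The power sum `p_k = ∑ i, x_i ^ k` as a formal power series (for `k ≥ 1`). -/
def powerSumSeries (k : ℕ) : MvPowerSeries ℕ ℚ :=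
  open Classical in fun d => if ∃ i, d = Finsupp.single i k then 1 else 0

/-- Expanding the product means choosing one variable `f i` from each factor. Positivity of the
weights lets `f` be recovered from the chosen monomials. -/
theorem coeff_prod_powerSumSeries {ι : Type*} [Fintype ι] (w : ι → ℕ) (hw : ∀ i, 0 < w i)
    (d : ℕ →₀ ℕ) :
    MvPowerSeries.coeff d (∏ i, powerSumSeries (w i)) =
      (Nat.card {f : ι → ℕ // ∑ i, Finsupp.single (f i) (w i) = d} : ℚ) := by
  classical
  rw [MvPowerSeries.coeff_prod]
  have h1 : ∀ l : ι →₀ ℕ →₀ ℕ, ∏ i, MvPowerSeries.coeff (l i) (powerSumSeries (w i)) =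
      if ∀ i, ∃ j, l i = Finsupp.single j (w i) then (1 : ℚ) else 0 := by
    intro l
    have : ∀ i, MvPowerSeries.coeff (l i) (powerSumSeries (w i)) =
        if ∃ j, l i = Finsupp.single j (w i) then (1 : ℚ) else 0 := fun i => rfl
    simp_rw [this]
    split_ifs with h
    · exact prod_eq_one fun i _ => if_pos (h i)
    · push Not at h
      obtain ⟨i, hi⟩ := h
      exact prod_eq_zero (mem_univ i) (if_neg (by push Not; exact hi))
  simp_rw [h1]
  rw [sum_boole]
  congr 1
  refine Eq.trans (Nat.subtype_card _ fun _ => Iff.rfl).symm (Eq.symm ?_)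
  refine Nat.card_eq_of_bijective (fun f : {f : ι → ℕ // ∑ i, Finsupp.single (f i) (w i) = d} =>
    (⟨Finsupp.equivFunOnFinite.symm fun i => Finsupp.single (f.1 i) (w i), ?_⟩ :
      {l // l ∈ {l ∈ finsuppAntidiag (univ : Finset ι) d | ∀ i, ∃ j, l i = Finsupp.single j (w i)}})) ⟨?_, ?_⟩
  · rw [mem_filter, mem_finsuppAntidiag]
    exact ⟨⟨by simpa using f.2, by simp⟩, fun i => ⟨f.1 i, rfl⟩⟩
  · intro f g hfg
    ext i
    have := DFunLike.congr_fun (congrArg Subtype.val hfg) i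
    exact Finsupp.single_left_injective (hw i).ne' this
  · rintro ⟨l, hl⟩
    rw [mem_filter, mem_finsuppAntidiag] at hl
    choose f hf using hl.2
    refine ⟨⟨f, ?_⟩, ?_⟩
    · rw [← hl.1.1]
      exact sum_congr rfl fun i _ => (hf i).symm
    · ext1
      ext1 i
      exact (hf i).symm

theorem finite_content {V : Type*} [Fintype V] (d : ℕ →₀ ℕ) :
    {κ : V → ℕ | ∑ v, Finsupp.single (κ v) 1 = d}.Finite := by
  have := SimpleGraph.finite_coloring_monomial (⊥ : SimpleGraph V) d
  refine Set.toFinite _ |>.subset (s := Set.range fun κ :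
    {κ : (⊥ : SimpleGraph V).Coloring ℕ // ∑ v, Finsupp.single (κ v) 1 = d} => (κ.1 : V → ℕ)) ?_
  intro κ hκ
  exact ⟨⟨SimpleGraph.Coloring.mk κ fun {u v} h => h.elim, hκ⟩, rfl⟩

/-- Inclusion–exclusion over an abstract family of forbidden events, so that it serves both for the
edges of a graph and for the leaves of a star. -/
theorem coeff_chromaticSymm_eq_sum_powerset {V ι : Type*} [Fintype V] (G : SimpleGraph V)
    (I : Finset ι) (mono : ι → (V → ℕ) → Prop)
    (h : ∀ κ : V → ℕ, (∀ u v, G.Adj u v → κ u ≠ κ v) ↔ ∀ i ∈ I, ¬ mono i κ) (d : ℕ →₀ ℕ) :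
    MvPowerSeries.coeff d G.chromaticSymm = ∑ T ∈ I.powerset, (-1) ^ #T *
      (Nat.card {κ : V → ℕ // ∑ v, Finsupp.single (κ v) 1 = d ∧ ∀ i ∈ T, mono i κ} : ℚ) := by
  classical
  set A := (finite_content (V := V) d).toFinset with hA
  have hmem : ∀ κ : V → ℕ, κ ∈ A ↔ ∑ v, Finsupp.single (κ v) 1 = d := by simp [hA]
  have h1 : ∀ P : (V → ℕ) → Prop,
      (Nat.card {κ : V → ℕ // ∑ v, Finsupp.single (κ v) 1 = d ∧ P κ} : ℚ) =
        ∑ κ ∈ A, if P κ then 1 else 0 := by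
    intro P
    rw [sum_boole, Nat.subtype_card]
    simp [hmem]
  have h2 : MvPowerSeries.coeff d G.chromaticSymm =
      (Nat.card {κ : V → ℕ // ∑ v, Finsupp.single (κ v) 1 = d ∧ ∀ i ∈ I, ¬ mono i κ} : ℚ) := by
    change ((Nat.card _ : ℕ) : ℚ) = _
    congr 1
    exact Nat.card_congr
      { toFun := fun κ => ⟨κ.1, κ.2, (h _).1 fun u v huv => κ.1.valid huv⟩
        invFun := fun κ => ⟨SimpleGraph.Coloring.mk κ.1 fun {u v} huv => (h _).2 κ.2.2 u v huv, κ.2.1⟩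
        left_inv := fun κ => rfl
        right_inv := fun κ => rfl }
  rw [h2]
  simp_rw [h1, mul_sum]
  rw [sum_comm]
  refine sum_congr rfl fun κ _ => ?_
  simp_rw [mul_ite, mul_one, mul_zero]
  rw [← sum_filter]
  have h3 : I.powerset.filter (fun T => ∀ i ∈ T, mono i κ) = (I.filter (mono · κ)).powerset := by
    ext T
    simp [Finset.subset_iff]
    grind
  rw [h3]
  have h4 := sum_powerset_neg_one_pow_card (x := I.filter (mono · κ))
  have h5 : ∑ T ∈ (I.filter (mono · κ)).powerset, (-1 : ℚ) ^ #T =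
      if I.filter (mono · κ) = ∅ then 1 else 0 := by
    exact_mod_cast congrArg (Int.cast : ℤ → ℚ) h4
  rw [h5]
  simp [Finset.filter_eq_empty_iff]

/-- A colouring constant on the fibres of `π` is a colouring of the fibres, each contributing its
colour as often as its size. -/
theorem coeff_prod_powerSumSeries_fiber {V ι : Type*} [Fintype V] [Fintype ι] [DecidableEq ι]
    (π : V → ι) (hπ : Function.Surjective π) (d : ℕ →₀ ℕ) :
    MvPowerSeries.coeff d (∏ b, powerSumSeries #{v | π v = b}) =
      (Nat.card {κ : V → ℕ // ∑ v, Finsupp.single (κ v) 1 = d ∧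
        ∀ u v, π u = π v → κ u = κ v} : ℚ) := by
  rw [coeff_prod_powerSumSeries]
  · congr 1
    have key : ∀ f : ι → ℕ, ∑ v, Finsupp.single (f (π v)) 1 =
        ∑ b, Finsupp.single (f b) #{v | π v = b} := by
      intro f
      rw [← sum_fiberwise (s := univ) (g := π)]
      refine sum_congr rfl fun b _ => ?_
      rw [sum_congr rfl (g := fun _ => Finsupp.single (f b) 1), sum_const, Finsupp.smul_single]
      · simp
      · intro v hv
        simp only [mem_filter, mem_univ, true_and] at hv
        rw [hv]
    refine Nat.card_congr
      { toFun := fun f => ⟨f.1 ∘ π, (key f.1).trans f.2, fun u v h => congrArg f.1 h⟩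
        invFun := fun κ => ⟨κ.1 ∘ Function.surjInv hπ, ?_⟩
        left_inv := ?_
        right_inv := ?_ }
    · refine (key _).symm.trans (Eq.trans ?_ κ.2.1)
      refine sum_congr rfl fun v _ => ?_
      congr 1
      exact κ.2.2 _ _ (Function.surjInv_eq hπ _)
    · intro f
      ext b
      simp [Function.surjInv_eq hπ]
    · intro κ
      ext v
      exact κ.2.2 _ _ (Function.surjInv_eq hπ _)
  · intro b
    obtain ⟨v, rfl⟩ := hπ b
    exact card_pos.2 ⟨v, by simp⟩

/-! ### Stars and power sums determine each other. -/

theorem starSymm_succ (k : ℕ) :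
    starSymm (k + 1) = ∑ j ∈ range (k + 1), ((-1 : ℚ) ^ j * (k.choose j : ℚ)) •
      (powerSumSeries (j + 1) * powerSumSeries 1 ^ (k - j)) := by
  classical
  have h1 : ∀ T : Finset (Fin k), ∀ d,
      (Nat.card {κ : Fin (k + 1) → ℕ // ∑ v, Finsupp.single (κ v) 1 = d ∧
        ∀ i ∈ T, κ i.succ = κ 0} : ℚ) = MvPowerSeries.coeff d
          (powerSumSeries (#T + 1) * powerSumSeries 1 ^ (k - #T)) := by
    intro T d
    -- `π` merges the centre with the leaves in `T` into the block `none`; each remaining leaf is a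
    -- block of its own.
    let π : Fin (k + 1) → Option {i // i ∉ T} :=
      Fin.cases none fun i => if h : i ∈ T then none else some ⟨i, h⟩
    have hπ : Function.Surjective π := by
      rintro (_ | ⟨i, hi⟩)
      · exact ⟨0, rfl⟩
      · exact ⟨i.succ, by simp [π, hi]⟩
    have h2 := coeff_prod_powerSumSeries_fiber π hπ d
    rw [Fintype.prod_option] at h2
    have h3 : #{v | π v = none} = #T + 1 := by
      rw [Fin.univ_succ, filter_cons]
      simp [π, filter_map, Function.comp_def]
    have h4 : ∀ b : {i // i ∉ T}, #{v | π v = some b} = 1 := by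
      rintro ⟨i, hi⟩
      rw [card_eq_one]
      refine ⟨i.succ, ?_⟩
      ext v
      cases v using Fin.cases with
      | zero => simp [π, (Fin.succ_ne_zero i).symm]
      | succ j =>
        by_cases hj : j ∈ T
        · simp [π, hj]; rintro rfl; exact hi hj
        · simp [π, hj]
    simp_rw [h3, h4] at h2
    rw [prod_const, card_univ, Fintype.card_subtype_compl, Fintype.card_fin,
      Fintype.card_coe] at h2
    rw [h2]
    congr 1
    refine Nat.card_congr (Equiv.subtypeEquivRight fun κ => and_congr_right fun _ => ⟨?_, ?_⟩)
    · intro h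
      have h0 : ∀ v, π v = none → κ v = κ 0 := by
        intro v hv
        cases v using Fin.cases with
        | zero => rfl
        | succ j =>
          by_cases hj : j ∈ T
          · exact h j hj
          · simp [π, hj] at hv
      intro u v huv
      rcases hv : π v with _ | b
      · rw [h0 v hv, h0 u (huv.trans hv)]
      · obtain ⟨x, hx⟩ := card_eq_one.1 (h4 b)
        have hu' : u ∈ ({x} : Finset _) := by rw [← hx]; simp [huv, hv]
        have hv' : v ∈ ({x} : Finset _) := by rw [← hx]; simp [hv]
        rw [mem_singleton.1 hu', mem_singleton.1 hv']
    · intro h i hi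
      exact h _ _ (by simp [π, hi])
  ext d
  rw [starSymm, coeff_chromaticSymm_eq_sum_powerset _ (univ : Finset (Fin k))
    (fun i κ => κ i.succ = κ 0)]
  · simp_rw [h1]
    rw [sum_powerset_apply_card (fun j => (-1 : ℚ) ^ j * MvPowerSeries.coeff d
      (powerSumSeries (j + 1) * powerSumSeries 1 ^ (k - j)))]
    simp only [card_univ, Fintype.card_fin, map_sum, map_smul, smul_eq_mul, nsmul_eq_mul]
    exact sum_congr rfl fun j _ => by ring
  · intro κ
    simp only [SimpleGraph.starGraph_adj, mem_univ, true_implies]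
    constructor
    · intro h i
      exact h _ _ (by simp [Fin.succ_ne_zero])
    · intro h u v huv
      cases u using Fin.cases with
      | zero =>
        cases v using Fin.cases with
        | zero => simp at huv
        | succ j => exact fun e => h j e.symm
      | succ i =>
        cases v using Fin.cases with
        | zero => exact h i
        | succ j => simp [Fin.succ_ne_zero] at huv

/-- `∑ i, (-1)^i (j choose i) X_i X_0^(j-i)`: the substitution `X_j ↦ binomTransform j` is an
involution. It exchanges power sums and chromatic symmetric functions of stars. -/
def binomTransform (j : ℕ) : MvPolynomial ℕ ℚ :=
  ∑ i ∈ range (j + 1), ((-1 : ℚ) ^ i * (j.choose i : ℚ)) • (X i * X 0 ^ (j - i))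

/-- Since `C(j,i) C(i,l) = C(j,l) C(j-l,i-l)`, this is `C(j,l)` times an alternating row sum of
Pascal's triangle, which is zero unless `j = l`. -/
theorem sum_neg_one_pow_choose_mul_choose (j l : ℕ) :
    ∑ i ∈ range (j + 1), (-1 : ℚ) ^ (i + l) * (j.choose i : ℚ) * (i.choose l : ℚ) =
      if j = l then 1 else 0 := by
  rcases lt_or_ge j l with h | h
  · rw [if_neg h.ne]
    refine sum_eq_zero fun i hi => ?_
    rw [Nat.choose_eq_zero_of_lt (by rw [mem_range] at hi; omega : i < l)]
    simp
  · obtain ⟨m, rfl⟩ := Nat.exists_eq_add_of_le h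
    have h1 : ∀ i ∈ range (l + m + 1), i ∉ Ico l (l + m + 1) →
        (-1 : ℚ) ^ (i + l) * ((l + m).choose i : ℚ) * (i.choose l : ℚ) = 0 := by
      intro i hi hi'
      rw [mem_range] at hi
      rw [mem_Ico] at hi'
      rw [Nat.choose_eq_zero_of_lt (by omega : i < l)]
      simp
    rw [← sum_subset (fun i hi => by rw [mem_Ico] at hi; rw [mem_range]; omega) h1,
      sum_Ico_eq_sum_range, show l + m + 1 - l = m + 1 by omega]
    have h2 : ∀ i ∈ range (m + 1),
        (-1 : ℚ) ^ (l + i + l) * ((l + m).choose (l + i) : ℚ) * ((l + i).choose l : ℚ) =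
          ((l + m).choose l : ℚ) * (((-1 : ℤ) ^ i * (m.choose i : ℤ) : ℤ) : ℚ) := by
      intro i hi
      rw [mem_range] at hi
      have h3 := Nat.choose_mul (n := l + m) (k := l + i) (s := l) (by omega)
      rw [show l + m - l = m by omega, show l + i - l = i by omega] at h3
      rw [mul_assoc, ← Nat.cast_mul, h3, show l + i + l = i + 2 * l by ring, pow_add, pow_mul]
      push_cast
      ring
    rw [sum_congr rfl h2, ← mul_sum, ← Int.cast_sum, Int.alternating_sum_range_choose]
    by_cases hm : m = 0
    · simp [hm]
    · simp [hm]

theorem bind₁_binomTransform (j : ℕ) : bind₁ binomTransform (binomTransform j) = X j := by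
  have h0 : binomTransform 0 = X 0 := by simp [binomTransform]
  have hext : ∀ i ≤ j, binomTransform i = ∑ l ∈ range (j + 1),
      ((-1 : ℚ) ^ l * (i.choose l : ℚ)) • (X l * X 0 ^ (i - l)) := by
    intro i hi
    refine sum_subset (range_subset_range.2 (by omega)) fun l _ hl => ?_
    rw [Nat.choose_eq_zero_of_lt (by simpa using hl)]
    simp
  rw [binomTransform, map_sum]
  simp_rw [map_smul, map_mul, map_pow, bind₁_X_right, h0]
  have h1 : ∀ i ∈ range (j + 1), ((-1 : ℚ) ^ i * (j.choose i : ℚ)) •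
      (binomTransform i * X 0 ^ (j - i)) = ∑ l ∈ range (j + 1),
      ((-1 : ℚ) ^ (i + l) * (j.choose i : ℚ) * (i.choose l : ℚ)) •
        (X l * X 0 ^ (j - l) : MvPolynomial ℕ ℚ) := by
    intro i hi
    rw [mem_range] at hi
    rw [hext i (by omega), sum_mul, smul_sum]
    refine sum_congr rfl fun l _ => ?_
    rcases lt_or_ge i l with h | h
    · rw [Nat.choose_eq_zero_of_lt h]
      simp
    · rw [smul_mul_assoc, smul_smul, mul_assoc (X l), ← pow_add,
        show i - l + (j - i) = j - l by omega]
      congr 1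
      ring
  rw [sum_congr rfl h1, sum_comm]
  simp_rw [← sum_smul, sum_neg_one_pow_choose_mul_choose]
  simp

/-! ### Algebraic independence of power sums and of stars. -/

/-- Evaluation of polynomials at `X_i = p_{i+1}`. -/
def powerSumEval : MvPolynomial ℕ ℚ →ₐ[ℚ] MvPowerSeries ℕ ℚ :=
  aeval fun i => powerSumSeries (i + 1)

/-- Evaluation of polynomials at `X_i = st_{i+1}`. -/
def starEval : MvPolynomial ℕ ℚ →ₐ[ℚ] MvPowerSeries ℕ ℚ :=
  aeval fun i => starSymm (i + 1)

theorem powerSumEval_bind₁ (P : MvPolynomial ℕ ℚ) :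
    powerSumEval (bind₁ binomTransform P) = starEval P := by
  have : powerSumEval.comp (bind₁ binomTransform) = starEval := by
    refine algHom_ext fun i => ?_
    simp [powerSumEval, starEval, binomTransform, starSymm_succ]
  exact DFunLike.congr_fun this P

theorem starEval_binomTransform (j : ℕ) :
    starEval (binomTransform j) = powerSumSeries (j + 1) := by
  rw [← powerSumEval_bind₁, bind₁_binomTransform]
  simp [powerSumEval]

theorem card_support_sum_single_le {ι : Type*} [Fintype ι] (f : ι → ℕ) (w : ι → ℕ) :
    #(∑ i, Finsupp.single (f i) (w i)).support ≤ #(univ.image f) := by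
  classical
  refine card_le_card fun a ha => ?_
  rw [Finsupp.mem_support_iff, Finsupp.finsetSum_apply] at ha
  obtain ⟨i, _, hi⟩ := exists_ne_zero_of_sum_ne_zero ha
  refine mem_image.2 ⟨i, mem_univ _, ?_⟩
  by_contra h
  exact hi (Finsupp.single_eq_of_ne (Ne.symm h))

theorem finite_sum_single_eq {ι : Type*} [Fintype ι] (w : ι → ℕ) (hw : ∀ i, 0 < w i)
    (d : ℕ →₀ ℕ) : Finite {f : ι → ℕ // ∑ i, Finsupp.single (f i) (w i) = d} := by
  refine Set.Finite.subset (Set.Finite.pi' fun _ : ι => d.support.finite_toSet) ?_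
  rintro f rfl i
  rw [mem_coe, Finsupp.mem_support_iff, Finsupp.finsetSum_apply]
  exact (sum_pos' (fun _ _ => Nat.zero_le _) ⟨i, mem_univ _, by simpa using hw i⟩).ne'

theorem map_support_sum_single {ι : Type*} [Fintype ι] (f : ι → ℕ) (hf : Function.Injective f)
    (w : ι → ℕ) (hw : ∀ i, 0 < w i) :
    (∑ i, Finsupp.single (f i) (w i)).support.val.map ⇑(∑ i, Finsupp.single (f i) (w i)) =
      univ.val.map w := by
  classical
  have h1 : ∀ i, (∑ i, Finsupp.single (f i) (w i)) (f i) = w i := by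
    intro i
    rw [Finsupp.finsetSum_apply, sum_eq_single i]
    · simp
    · intro j _ hj
      exact Finsupp.single_eq_of_ne (hf.ne hj).symm
    · simp
  have h2 : (∑ i, Finsupp.single (f i) (w i)).support = univ.map ⟨f, hf⟩ := by
    ext a
    simp only [mem_map, mem_univ, true_and, Function.Embedding.coeFn_mk, Finsupp.mem_support_iff]
    constructor
    · intro ha
      rw [Finsupp.finsetSum_apply] at ha
      obtain ⟨i, _, hi⟩ := exists_ne_zero_of_sum_ne_zero ha
      refine ⟨i, ?_⟩
      by_contra h
      exact hi (Finsupp.single_eq_of_ne (Ne.symm h))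
    · rintro ⟨i, rfl⟩
      rw [h1]
      exact (hw i).ne'
  rw [h2, map_val, Multiset.map_map]
  exact Multiset.map_congr rfl fun i _ => h1 i

theorem aeval_monomial_toFinsupp {A : Type*} [CommSemiring A] [Algebra ℚ A] (g : ℕ → A)
    (s : Multiset ℕ) : aeval g (monomial (Multiset.toFinsupp s) (1 : ℚ)) = (s.map g).prod := by
  induction s using Multiset.induction_on with
  | empty => simp
  | cons a s ih =>
    rw [Multiset.map_cons, Multiset.prod_cons, ← ih, ← Multiset.singleton_add, map_add,
      ← one_mul (1 : ℚ), ← monomial_mul, map_mul, Multiset.toFinsupp_singleton, one_mul]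
    congr 1
    exact aeval_X g a

theorem powerSumEval_monomial (m : ℕ →₀ ℕ) :
    powerSumEval (monomial m 1) =
      ∏ x : Finsupp.toMultiset m, powerSumSeries ((x : ℕ) + 1) := by
  conv_lhs => rw [← Finsupp.toMultiset_toFinsupp m]
  rw [powerSumEval, aeval_monomial_toFinsupp, prod_eq_multiset_prod,
    Multiset.map_univ _ fun i => powerSumSeries (i + 1)]

/-- Take a monomial `m` of `P` with the most factors, and let `d` use a different variable for each
of them. A monomial `m'` of `P` reaches `x^d` only if it has at least as many factors as `d` has
variables. By maximality the numbers agree, its factors also use distinct variables, and the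
multiset of exponents forces `m' = m`. So the coefficient of `x^d` is a nonzero multiple of that of
`m`. -/
theorem powerSumEval_injective : Function.Injective powerSumEval := by
  classical
  rw [injective_iff_map_eq_zero]
  intro P hP
  by_contra hne
  obtain ⟨m, hm, hmax⟩ := exists_max_image P.support (fun m => (Finsupp.toMultiset m).card)
    (support_nonempty.2 hne)
  let e : Finsupp.toMultiset m → ℕ := fun x => (Fintype.equivFin _ x : ℕ)
  have he : Function.Injective e := Fin.val_injective.comp (Equiv.injective _)
  set d : ℕ →₀ ℕ := ∑ x, Finsupp.single (e x) ((x : ℕ) + 1) with hd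
  have hcoeff : ∀ m', MvPowerSeries.coeff d (powerSumEval (monomial m' 1)) =
      (Nat.card {f : Finsupp.toMultiset m' → ℕ //
        ∑ i, Finsupp.single (f i) ((i : ℕ) + 1) = d} : ℚ) := fun m' => by
    rw [powerSumEval_monomial, coeff_prod_powerSumSeries _ fun _ => Nat.succ_pos _]
  have hdcard : #d.support = (Finsupp.toMultiset m).card := by
    have := congrArg Multiset.card (map_support_sum_single e he (fun x => (x : ℕ) + 1)
      fun _ => Nat.succ_pos _)
    rw [Multiset.card_map, Multiset.card_map, ← hd] at this
    exact this.trans (by simp)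
  have hmain : ∀ m' ∈ P.support, m' ≠ m →
      MvPowerSeries.coeff d (powerSumEval (monomial m' 1)) = 0 := by
    intro m' hm' hmm
    rw [hcoeff, Nat.cast_eq_zero, Nat.card_eq_zero]
    refine Or.inl ⟨fun ⟨f, hf⟩ => hmm ?_⟩
    have h1 := card_support_sum_single_le f (fun i => (i : ℕ) + 1)
    rw [hf, hdcard] at h1
    have h2 : #(univ.image f) ≤ #(univ : Finset (Finsupp.toMultiset m')) := card_image_le
    have h3 : #(univ : Finset (Finsupp.toMultiset m')) = (Finsupp.toMultiset m').card := by
      simp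
    have h4 := hmax m' hm'
    have hinj : Function.Injective f := by
      rw [← Set.injOn_univ, ← coe_univ]
      exact card_image_iff.1 (by omega)
    have h5 := map_support_sum_single f hinj (fun i => (i : ℕ) + 1) fun _ => Nat.succ_pos _
    rw [hf, map_support_sum_single e he (fun x => (x : ℕ) + 1) fun _ => Nat.succ_pos _] at h5
    rw [Multiset.map_univ _ (· + 1), Multiset.map_univ _ (· + 1)] at h5
    exact ((Function.LeftInverse.injective Finsupp.toMultiset_toFinsupp)
      (Multiset.map_injective (add_left_injective 1) h5)).symm
  have hfin := congrArg (MvPowerSeries.coeff d) hP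
  rw [P.as_sum, map_sum, map_sum, sum_eq_single m, map_zero] at hfin
  · have h6 : monomial m (coeff m P) = coeff m P • monomial m 1 := by simp [smul_monomial]
    rw [h6, map_smul, map_smul, smul_eq_mul, hcoeff] at hfin
    rcases mul_eq_zero.1 hfin with h | h
    · exact mem_support_iff.1 hm h
    · rw [Nat.cast_eq_zero] at h
      have : Finite {f : Finsupp.toMultiset m → ℕ //
          ∑ i, Finsupp.single (f i) ((i : ℕ) + 1) = d} := finite_sum_single_eq _ (fun _ => Nat.succ_pos _) d
      have : Nonempty {f : Finsupp.toMultiset m → ℕ //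
        ∑ i, Finsupp.single (f i) ((i : ℕ) + 1) = d} := ⟨e, rfl⟩
      exact Nat.card_pos.ne' h
  · intro m' hm' hmm
    have h6 : monomial m' (coeff m' P) = coeff m' P • monomial m' 1 := by simp [smul_monomial]
    rw [h6, map_smul, map_smul, hmain m' hm' hmm, smul_zero]
  · exact fun h => (h hm).elim

/-- Evaluation at stars is evaluation at power sums after an involution. -/
theorem starEval_injective : Function.Injective starEval := by
  intro P Q h
  rw [← powerSumEval_bind₁, ← powerSumEval_bind₁] at h
  have h1 := congrArg (bind₁ binomTransform) (powerSumEval_injective h)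
  have h2 : (bind₁ binomTransform).comp (bind₁ binomTransform) = AlgHom.id ℚ _ :=
    algHom_ext fun i => by simp [bind₁_binomTransform]
  exact (DFunLike.congr_fun h2 P).symm.trans (h1.trans (DFunLike.congr_fun h2 Q))

/-! ### Partitions of `n` as monomials of weighted degree `n`. -/

/-- The exponent of the monomial in the `X_i` that evaluates to `st_lam` at `X_i = st_{i+1}`. -/
def partExponent {n : ℕ} (lam : n.Partition) : ℕ →₀ ℕ :=
  Multiset.toFinsupp (lam.parts.map (· - 1))

theorem partExponent_injective {n : ℕ} : Function.Injective (partExponent (n := n)) := by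
  intro lam mu h
  have h1 := Multiset.toFinsupp.injective h
  have h2 : ∀ nu : n.Partition, (nu.parts.map (· - 1)).map (· + 1) = nu.parts := by
    intro nu
    rw [Multiset.map_map]
    conv_rhs => rw [← Multiset.map_id nu.parts]
    refine Multiset.map_congr rfl fun i hi => ?_
    have := nu.parts_pos hi
    simp only [Function.comp_apply, id]
    omega
  ext1
  rw [← h2 lam, ← h2 mu, h1]

theorem starEval_monomial_partExponent {n : ℕ} (lam : n.Partition) :
    starEval (monomial (partExponent lam) 1) = starSymmPart lam := by
  rw [partExponent, starEval, aeval_monomial_toFinsupp, starSymmPart, Multiset.map_map]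
  congr 1
  refine Multiset.map_congr rfl fun i hi => ?_
  have := lam.parts_pos hi
  simp only [Function.comp_apply]
  congr 1
  omega

theorem sum_map_toMultiset (m : ℕ →₀ ℕ) :
    ((Finsupp.toMultiset m).map (· + 1)).sum = Finsupp.weight (fun i => i + 1) m := by
  induction m using Finsupp.induction_linear with
  | zero => simp
  | add f g hf hg => simp only [map_add, Multiset.map_add, Multiset.sum_add, hf, hg]
  | single i k => simp [Finsupp.weight_apply, Finsupp.toMultiset_single, Multiset.map_nsmul, Multiset.sum_nsmul]

theorem exists_partExponent_eq {n : ℕ} (m : ℕ →₀ ℕ)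
    (hm : Finsupp.weight (fun i => i + 1) m = n) : ∃ lam : n.Partition, partExponent lam = m := by
  refine ⟨⟨(Finsupp.toMultiset m).map (· + 1), ?_, ?_⟩, ?_⟩
  · intro i hi
    obtain ⟨j, -, rfl⟩ := Multiset.mem_map.1 hi
    exact Nat.succ_pos j
  · rw [← hm, sum_map_toMultiset]
  · simp [partExponent, Multiset.map_map]

theorem starEval_eq_sum_partition {n : ℕ} {Q : MvPolynomial ℕ ℚ}
    (hQ : IsWeightedHomogeneous (fun i => i + 1) Q n) :
    starEval Q = ∑ lam : n.Partition, coeff (partExponent lam) Q • starSymmPart lam := by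
  classical
  have h1 : Q = ∑ lam : n.Partition, coeff (partExponent lam) Q •
      monomial (partExponent lam) (1 : ℚ) := by
    ext m
    simp only [coeff_sum, coeff_smul, coeff_monomial, smul_eq_mul, mul_ite, mul_one, mul_zero]
    by_cases hm : coeff m Q = 0
    · rw [hm, sum_eq_zero]
      intro lam _
      split_ifs with h
      · rw [h, hm]
      · rfl
    · obtain ⟨lam, rfl⟩ := exists_partExponent_eq m (hQ hm)
      rw [sum_eq_single lam]
      · simp
      · intro mu _ h
        exact if_neg fun h' => h (partExponent_injective h')
      · simp
  conv_lhs => rw [h1]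
  simp_rw [map_sum, map_smul, starEval_monomial_partExponent]

theorem linearIndependent_starSymmPart (n : ℕ) :
    LinearIndependent ℚ (fun lam : n.Partition => starSymmPart lam) := by
  have h := ((basisMonomials ℕ ℚ).linearIndependent.comp _
    (partExponent_injective (n := n))).map' starEval.toLinearMap
    (LinearMap.ker_eq_bot.2 starEval_injective)
  have h1 : (fun lam : n.Partition => starSymmPart lam) =
      starEval.toLinearMap ∘ (basisMonomials ℕ ℚ) ∘ partExponent := by
    ext1 lam
    simp [starEval_monomial_partExponent]
  rw [h1]
  exact h

/-! ### Extracting hook coefficients with dual numbers. -/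

/-- The substitution `X_0 ↦ 1`, `X_i ↦ ε`, `X_j ↦ 0` otherwise. -/
def hookSubst (i j : ℕ) : DualNumber ℚ :=
  if j = 0 then 1 else if j = i then DualNumber.eps else 0

theorem prod_hookSubst (i : ℕ) (s : Multiset ℕ) :
    (s.map (hookSubst i)).prod = if s.filter (· ≠ 0) = 0 then 1 else
      if s.filter (· ≠ 0) = {i} then DualNumber.eps else 0 := by
  induction s using Multiset.induction_on with
  | empty => simp
  | cons a s ih =>
    rw [Multiset.map_cons, Multiset.prod_cons, ih]
    by_cases ha : a = 0
    · subst ha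
      rw [Multiset.filter_cons_of_neg _ (by simp)]
      simp [hookSubst]
    · rw [Multiset.filter_cons_of_pos (p := fun a => a ≠ 0) _ ha]
      simp only [hookSubst, ha, if_false, Multiset.cons_ne_zero]
      generalize Multiset.filter (fun a => a ≠ 0) s = t
      by_cases hai : a = i
      · subst hai
        simp only [if_true]
        by_cases h0 : t = 0
        · simp [h0]
        · have : ¬ (a ::ₘ t = {a}) := by
            rw [← Multiset.cons_zero, Multiset.cons_inj_right]
            exact h0
          rw [if_neg h0, if_neg this]
          split_ifs <;> simp
      · have : ¬ (a ::ₘ t = {i}) := by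
          intro h
          have : a ∈ ({i} : Multiset ℕ) := h ▸ Multiset.mem_cons_self _ _
          exact hai (Multiset.mem_singleton.1 this)
        rw [if_neg hai, if_neg this, zero_mul]

/-- The fixed weighted degree determines how many zeros accompany the nonzero entries. -/
theorem filter_ne_zero_eq_iff {n : ℕ} {s : Multiset ℕ} (hs : (s.map (· + 1)).sum = n)
    (t : Multiset ℕ) (ht : 0 ∉ t) : s.filter (· ≠ 0) = t ↔
      s = Multiset.replicate (n - (t.map (· + 1)).sum) 0 + t := by
  constructor
  · rintro rfl
    have h1 : s.filter (· = 0) + s.filter (· ≠ 0) = s := Multiset.filter_add_not _ _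
    rw [Multiset.filter_eq'] at h1
    have h2 := congrArg (fun u => (u.map (· + 1)).sum) h1
    simp only [Multiset.map_add, Multiset.sum_add, Multiset.map_replicate, Multiset.sum_replicate,
      smul_eq_mul, hs] at h2
    conv_lhs => rw [← h1]
    congr 2
    simp only [ne_eq] at h2 ⊢
    omega
  · intro h
    rw [h, Multiset.filter_add, Multiset.filter_eq_nil.2, zero_add, Multiset.filter_eq_self]
    · exact fun a ha h0 => ht (h0 ▸ ha)
    · intro a ha
      simp [Multiset.eq_of_mem_replicate ha]

/-- A monomial survives only with no variable besides `X 0`, or with a single `X i` besides powers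
of `X 0`. Homogeneity leaves one monomial of each kind, and when `i + 1 > n` the second coefficient
is zero. -/
theorem aeval_hookSubst_eq {n i : ℕ} (hi : i ≠ 0) {Q : MvPolynomial ℕ ℚ}
    (hQ : IsWeightedHomogeneous (fun i => i + 1) Q n) :
    aeval (hookSubst i) Q = coeff (Finsupp.single 0 n) Q • 1 +
      coeff (Finsupp.single 0 (n - (i + 1)) + Finsupp.single i 1) Q • DualNumber.eps := by
  classical
  have h1 : ∀ m ∈ Q.support, aeval (hookSubst i) (monomial m (coeff m Q)) =
      (if Finsupp.single 0 n = m then coeff m Q • 1 else 0) +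
      (if Finsupp.single 0 (n - (i + 1)) + Finsupp.single i 1 = m
        then coeff m Q • DualNumber.eps else 0) := by
    intro m hm
    have hs := (sum_map_toMultiset m).trans (hQ (mem_support_iff.1 hm))
    have h2 : monomial m (coeff m Q) = coeff m Q • monomial m 1 := by simp [smul_monomial]
    have h3 : ∀ t, Finsupp.toMultiset m = t ↔ Multiset.toFinsupp t = m := by
      intro t
      constructor
      · rintro rfl; simp
      · rintro rfl; simp
    rw [h2, map_smul]
    conv_lhs => rw [← Finsupp.toMultiset_toFinsupp m, aeval_monomial_toFinsupp, prod_hookSubst,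
      Finsupp.toMultiset_toFinsupp]
    simp only [filter_ne_zero_eq_iff hs 0 (by simp),
      filter_ne_zero_eq_iff hs {i} (by simpa using hi.symm), h3, map_add, Multiset.toFinsupp_singleton]
    have h4 : ∀ k, Multiset.toFinsupp (Multiset.replicate k 0) = Finsupp.single 0 k := by
      intro k
      rw [← Multiset.nsmul_singleton, map_nsmul, Multiset.toFinsupp_singleton]
      simp
    simp only [h4, Multiset.map_zero, Multiset.sum_zero, Multiset.map_singleton,
      Multiset.sum_singleton, map_zero, add_zero, Nat.sub_zero]
    have h5 : Finsupp.single 0 n = m →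
        ¬ Finsupp.single 0 (n - (i + 1)) + Finsupp.single i 1 = m := by
      intro ha hb
      have := DFunLike.congr_fun (hb.trans ha.symm) i
      simp [hi.symm] at this
    split_ifs <;> simp_all
  conv_lhs => rw [Q.as_sum, map_sum, sum_congr rfl h1, sum_add_distrib, sum_ite_eq, sum_ite_eq]
  congr 1
  · split_ifs with h
    · rfl
    · rw [notMem_support_iff.1 h, zero_smul]
  · split_ifs with h
    · rfl
    · rw [notMem_support_iff.1 h, zero_smul]

/-- Only the terms `l = 0` and `l = i` of the transform survive. -/
theorem aeval_hookSubst_binomTransform (i j : ℕ) (hi : i ≠ 0) :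
    aeval (hookSubst i) (binomTransform j) =
      1 + ((-1 : ℚ) ^ i * (j.choose i : ℚ)) • DualNumber.eps := by
  have h1 : ∀ l ∈ range (j + 1), ((-1 : ℚ) ^ l * (j.choose l : ℚ)) • hookSubst i l =
      (if 0 = l then 1 else 0) +
      (if i = l then ((-1 : ℚ) ^ i * (j.choose i : ℚ)) • DualNumber.eps else 0) := by
    intro l _
    rcases eq_or_ne l 0 with rfl | hl
    · simp [hookSubst, hi]
    · rcases eq_or_ne l i with rfl | hli
      · simp [hookSubst, hl, hl.symm]
      · simp [hookSubst, hl, hl.symm, hli, hli.symm]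
  rw [binomTransform, map_sum]
  simp only [map_smul, map_mul, map_pow, aeval_X]
  have h0 : hookSubst i 0 = 1 := by simp [hookSubst]
  simp only [h0, one_pow, mul_one]
  rw [sum_congr rfl h1, sum_add_distrib, sum_ite_eq, sum_ite_eq, if_pos (by simp)]
  congr 1
  split_ifs with h
  · rfl
  · rw [Nat.choose_eq_zero_of_lt (by simpa using h)]
    simp

theorem prod_one_add_smul_eps {ι : Type*} (s : Finset ι) (a : ι → ℚ) :
    ∏ c ∈ s, (1 + a c • (DualNumber.eps : DualNumber ℚ)) = 1 + (∑ c ∈ s, a c) • DualNumber.eps := by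
  classical
  induction s using Finset.induction_on with
  | empty => simp
  | insert c s hc ih =>
    rw [prod_insert hc, sum_insert hc, ih]
    have : (DualNumber.eps : DualNumber ℚ) * DualNumber.eps = 0 := DualNumber.eps_mul_eps
    simp [add_mul, mul_add, add_smul, this]
    ring

theorem isWeightedHomogeneous_binomTransform (j : ℕ) :
    IsWeightedHomogeneous (fun i => i + 1) (binomTransform j) (j + 1) := by
  refine IsWeightedHomogeneous.sum _ _ _ fun i hi => ?_
  rw [smul_eq_C_mul]
  refine IsWeightedHomogeneous.C_mul ?_ _
  have h := (isWeightedHomogeneous_X ℚ (fun i : ℕ => i + 1) i).mul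
    ((isWeightedHomogeneous_X ℚ (fun i : ℕ => i + 1) 0).pow (j - i))
  rw [mem_range] at hi
  convert h using 1
  simp only [smul_eq_mul]
  omega

/-! ### The subgraph expansion of `X_G` and its hook coefficients. -/

theorem chromaticSymm_eq_sum_powerset {V : Type*} [Fintype V] (G : SimpleGraph V)
    [Fintype G.edgeSet]
    [∀ S : Finset (Sym2 V), Fintype (SimpleGraph.fromEdgeSet (S : Set (Sym2 V))).ConnectedComponent] :
    G.chromaticSymm = ∑ S ∈ G.edgeFinset.powerset, (-1 : ℚ) ^ #S •
      ∏ c : (SimpleGraph.fromEdgeSet (S : Set (Sym2 V))).ConnectedComponent,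
        powerSumSeries c.supp.ncard := by
  classical
  ext d
  rw [coeff_chromaticSymm_eq_sum_powerset G G.edgeFinset (fun e κ => (e.map κ).IsDiag), map_sum]
  · refine sum_congr rfl fun S hS => ?_
    rw [map_smul, smul_eq_mul]
    congr 1
    set H := SimpleGraph.fromEdgeSet (S : Set (Sym2 V)) with hH
    have h1 := coeff_prod_powerSumSeries_fiber H.connectedComponentMk
      (fun c => c.exists_rep) d
    have h2 : ∀ c : H.ConnectedComponent, #{v | H.connectedComponentMk v = c} = c.supp.ncard := by
      intro c
      rw [← Set.ncard_coe_finset]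
      congr 1
      ext v
      simp
    simp_rw [h2] at h1
    rw [h1]
    congr 1
    refine Nat.card_congr (Equiv.subtypeEquivRight fun κ => and_congr_right fun _ => ⟨?_, ?_⟩)
    · intro h u v huv
      obtain ⟨p⟩ := SimpleGraph.ConnectedComponent.exact huv
      induction p with
      | nil => rfl
      | cons hadj p ih =>
        rw [hH, SimpleGraph.fromEdgeSet_adj] at hadj
        have := h _ hadj.1
        simp only [Sym2.map_mk, Sym2.mk_isDiag_iff] at this
        exact this.trans (ih (SimpleGraph.ConnectedComponent.sound ⟨p⟩))
    · intro h e
      induction e using Sym2.ind with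
      | _ u v =>
        intro he
        simp only [Sym2.map_mk, Sym2.mk_isDiag_iff]
        refine h u v (SimpleGraph.ConnectedComponent.sound (SimpleGraph.Adj.reachable ?_))
        rw [hH, SimpleGraph.fromEdgeSet_adj]
        exact ⟨he, (SimpleGraph.mem_edgeFinset.1 (mem_powerset.1 hS he) : G.Adj u v).ne⟩
  · intro κ
    constructor
    · intro h e
      induction e using Sym2.ind with
      | _ u v =>
        intro he
        simpa using h u v (SimpleGraph.mem_edgeFinset.1 he)
    · intro h u v huv
      simpa using h s(u, v) (SimpleGraph.mem_edgeFinset.2 huv)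

/-- The alternating sum over all spanning subgraphs `S` of `G` of the numbers
`∑ (|K| - 1 choose i)`, where `K` ranges over the connected components of `S`. -/
def SimpleGraph.componentSum {V : Type*} [Fintype V] (G : SimpleGraph V) (i : ℕ) : ℚ :=
  open Classical in ∑ S ∈ G.edgeFinset.powerset, (-1 : ℚ) ^ #S *
    ∑ c : (SimpleGraph.fromEdgeSet (S : Set (Sym2 V))).ConnectedComponent,
      ((c.supp.ncard - 1).choose i : ℚ)

theorem sum_ncard_supp {V : Type*} [Fintype V] (H : SimpleGraph V) [Fintype H.ConnectedComponent] :
    ∑ c : H.ConnectedComponent, c.supp.ncard = Fintype.card V := by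
  classical
  rw [← card_univ, card_eq_sum_card_fiberwise (f := H.connectedComponentMk) (t := univ)
    fun _ _ => mem_coe.2 (mem_univ _)]
  refine sum_congr rfl fun c _ => ?_
  rw [← Set.ncard_coe_finset]
  congr 1
  ext v
  simp

theorem star_expansion_hook {V : Type*} [Fintype V] (G : SimpleGraph V) {n : ℕ}
    (hn : Fintype.card V = n) (hG : G ≠ ⊥) :
    (∃! a : n.Partition → ℚ, G.chromaticSymm = ∑ lam : n.Partition, a lam • starSymmPart lam) ∧
    ∀ a : n.Partition → ℚ, G.chromaticSymm = ∑ lam : n.Partition, a lam • starSymmPart lam →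
      ∀ lam : n.Partition,
        (lam.parts = Multiset.replicate n 1 → a lam = 0) ∧
        ∀ i ≠ 0, lam.parts = (i + 1) ::ₘ Multiset.replicate (n - (i + 1)) 1 →
          a lam = (-1) ^ i * G.componentSum i := by
  classical
  -- The subgraph expansion with each power sum rewritten in stars. It has weighted degree `n`
  -- because the component sizes add up to `n`.
  set Q : MvPolynomial ℕ ℚ := ∑ S ∈ G.edgeFinset.powerset, (-1 : ℚ) ^ #S •
      ∏ c : (SimpleGraph.fromEdgeSet (S : Set (Sym2 V))).ConnectedComponent,
        binomTransform (c.supp.ncard - 1) with hQ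
  have hpos : ∀ (H : SimpleGraph V) (c : H.ConnectedComponent), c.supp.ncard - 1 + 1 = c.supp.ncard :=
    fun H c => Nat.sub_add_cancel ((Set.ncard_pos (Set.toFinite _)).2 c.nonempty_supp)
  have hQhom : IsWeightedHomogeneous (fun i => i + 1) Q n := by
    refine IsWeightedHomogeneous.sum _ _ _ fun S _ => ?_
    rw [smul_eq_C_mul]
    refine IsWeightedHomogeneous.C_mul ?_ _
    have h := IsWeightedHomogeneous.prod univ _ _
      fun (c : (SimpleGraph.fromEdgeSet (S : Set (Sym2 V))).ConnectedComponent) _ =>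
        isWeightedHomogeneous_binomTransform (c.supp.ncard - 1)
    simp_rw [hpos] at h
    rwa [sum_ncard_supp, hn] at h
  have hQeval : starEval Q = G.chromaticSymm := by
    rw [chromaticSymm_eq_sum_powerset, hQ, map_sum]
    simp_rw [map_smul, map_prod, starEval_binomTransform, hpos]
  have hexp := starEval_eq_sum_partition hQhom
  rw [hQeval] at hexp
  have huniq : ∀ a : n.Partition → ℚ,
      G.chromaticSymm = ∑ lam : n.Partition, a lam • starSymmPart lam →
      a = fun lam => coeff (partExponent lam) Q := by
    intro a ha
    have h := hexp.symm.trans ha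
    exact ((linearIndependent_starSymmPart n).fintypeLinearCombination_injective
      (by simpa [Fintype.linearCombination_apply] using h)).symm
  refine ⟨⟨_, hexp, huniq⟩, fun a ha lam => ?_⟩
  have halam : a lam = coeff (partExponent lam) Q := congrFun (huniq a ha) lam
  rw [halam]
  have hcoeff : ∀ i ≠ 0, coeff (Finsupp.single 0 n) Q = 0 ∧
      coeff (Finsupp.single 0 (n - (i + 1)) + Finsupp.single i 1) Q =
        (-1) ^ i * G.componentSum i := by
    intro i hi
    have h1 := aeval_hookSubst_eq hi hQhom
    rw [hQ, map_sum, ← hQ] at h1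
    simp_rw [map_smul, map_prod, aeval_hookSubst_binomTransform i _ hi, prod_one_add_smul_eps,
      smul_add, smul_smul] at h1
    rw [sum_add_distrib, ← sum_smul, ← sum_smul] at h1
    have h2 := congrArg TrivSqZeroExt.fst h1
    have h3 := congrArg TrivSqZeroExt.snd h1
    -- The coefficient of `st_1^n` is a bare alternating sum over edge sets, which vanishes because
    -- there is at least one edge.
    have h4 : ∑ S ∈ G.edgeFinset.powerset, (-1 : ℚ) ^ #S = 0 := by
      have := sum_powerset_neg_one_pow_card_of_nonempty (x := G.edgeFinset)
        (SimpleGraph.edgeFinset_nonempty.2 hG)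
      exact_mod_cast congrArg (Int.cast : ℤ → ℚ) this
    simp only [TrivSqZeroExt.fst_add, TrivSqZeroExt.fst_smul, TrivSqZeroExt.fst_one,
      DualNumber.fst_eps, TrivSqZeroExt.snd_add, TrivSqZeroExt.snd_smul, TrivSqZeroExt.snd_one,
      DualNumber.snd_eps, smul_eq_mul, mul_one, mul_zero, add_zero, zero_add] at h2 h3
    refine ⟨h2.symm.trans h4, h3.symm.trans ?_⟩
    rw [SimpleGraph.componentSum, mul_sum]
    refine sum_congr rfl fun S _ => ?_
    rw [← mul_sum]
    ring
  constructor
  · intro h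
    rw [partExponent, h, Multiset.map_replicate, ← Multiset.nsmul_singleton, map_nsmul,
      Multiset.toFinsupp_singleton]
    simpa using (hcoeff 1 one_ne_zero).1
  · intro i hi h
    rw [← (hcoeff i hi).2, partExponent, h, Multiset.map_cons, Multiset.map_replicate,
      ← Multiset.nsmul_singleton, ← Multiset.singleton_add, map_add, map_nsmul,
      Multiset.toFinsupp_singleton, Multiset.toFinsupp_singleton, add_comm]
    simp
end

/-! ### Cycles, and unicyclic graphs as a tree plus an edge. -/

noncomputable section

open Finset

namespace SimpleGraph

variable {V : Type*} {G : SimpleGraph V}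

/-- Links the two notions of cycle: uniqueness is assumed for subgraphs, while acyclicity is stated
for closed walks. -/
theorem Walk.IsCycle.isCycleGraph_toSubgraph {u : V} {p : G.Walk u u} (hp : p.IsCycle) :
    p.toSubgraph.IsCycleGraph := by
  have h3 := hp.three_le_length
  refine ⟨p.length, h3, ⟨Iso.symm ?_⟩⟩
  let f : Fin p.length → p.toSubgraph.verts := fun i =>
    ⟨p.getVert i, p.mem_verts_toSubgraph.2 (p.getVert_mem_support _)⟩
  have hinj : Function.Injective f := by
    intro i j hij
    have h := congrArg Subtype.val hij
    exact Fin.ext (hp.getVert_injOn' (by rw [Set.mem_ofPred_eq]; omega)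
      (by rw [Set.mem_ofPred_eq]; omega) h)
  have hsurj : Function.Surjective f := by
    rintro ⟨v, hv⟩
    obtain ⟨i, rfl, hi⟩ := Walk.mem_support_iff_exists_getVert.1 (p.mem_verts_toSubgraph.1 hv)
    rcases hi.lt_or_eq with h | h
    · exact ⟨⟨i, h⟩, rfl⟩
    · exact ⟨⟨0, by omega⟩, Subtype.ext (by simp [f, h])⟩
  -- The only coincidence among the positions is that of the start and the end.
  have hval : ∀ i < p.length, ∀ j ≤ p.length, p.getVert i = p.getVert j →
      j = i ∨ (i = 0 ∧ j = p.length) := by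
    intro i hi j hj h
    rcases hj.lt_or_eq with h' | h'
    · left
      exact hp.getVert_injOn' (by rw [Set.mem_ofPred_eq]; omega)
        (by rw [Set.mem_ofPred_eq]; omega) h.symm
    · right
      refine ⟨?_, h'⟩
      rw [h', p.getVert_length] at h
      rcases (hp.getVert_endpoint_iff hi.le).1 h with h | h <;> omega
  refine ⟨Equiv.ofBijective f ⟨hinj, hsurj⟩, fun {i j} => ?_⟩
  rw [cycleGraph_adj']
  change p.toSubgraph.Adj (p.getVert i) (p.getVert j) ↔ _
  rw [Walk.toSubgraph_adj_iff]
  have hi := i.2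
  have hj := j.2
  have hsub : ∀ a b : Fin p.length, (a - b).val = 1 ↔
      a.val = b.val + 1 ∨ (a.val = 0 ∧ b.val + 1 = p.length) := by
    intro a b
    have ha := a.2
    have hb := b.2
    rw [Fin.sub_def]
    simp only
    rcases le_or_gt b.val a.val with h | h
    · rw [show p.length - b.val + a.val = (a.val - b.val) + p.length by omega, Nat.add_mod_right,
        Nat.mod_eq_of_lt (by omega)]
      omega
    · rw [Nat.mod_eq_of_lt (by omega)]
      omega
  rw [hsub, hsub]
  constructor
  · rintro ⟨l, hl, hlt⟩
    rw [Sym2.eq_iff] at hl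
    rcases hl with ⟨h1, h2⟩ | ⟨h1, h2⟩
    · have := hval i hi l hlt.le h1.symm
      have := hval j hj (l + 1) hlt h2.symm
      omega
    · have := hval j hj l hlt.le h1.symm
      have := hval i hi (l + 1) hlt h2.symm
      omega
  · rintro ((h | ⟨h, h'⟩) | (h | ⟨h, h'⟩))
    · exact ⟨j, by rw [h, Sym2.eq_swap], hj⟩
    · exact ⟨j, by rw [h, h', p.getVert_length, p.getVert_zero, Sym2.eq_swap], hj⟩
    · exact ⟨i, by rw [h], hi⟩
    · exact ⟨i, by rw [h, h', p.getVert_length, p.getVert_zero], hi⟩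

namespace Subgraph

variable {C : G.Subgraph}

theorem IsCycleGraph.ncard_neighborSet (hC : C.IsCycleGraph) {v : V} (hv : v ∈ C.verts) :
    (C.neighborSet v).ncard = 2 := by
  obtain ⟨m, hm, ⟨φ⟩⟩ := hC
  obtain ⟨m, rfl⟩ := Nat.exists_eq_add_of_le' hm
  have h1 := cycleGraph_degree_three_le (v := φ ⟨v, hv⟩)
  rw [← card_neighborSet_eq_degree, ← Nat.card_eq_fintype_card,
    ← Nat.card_congr (φ.mapNeighborSet ⟨v, hv⟩),
    Nat.card_congr (coeNeighborSetEquiv ⟨v, hv⟩)] at h1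
  exact h1

theorem IsCycleGraph.three_le_ncard (hC : C.IsCycleGraph) : 3 ≤ C.verts.ncard := by
  obtain ⟨m, hm, ⟨φ⟩⟩ := hC
  have h1 := Nat.card_congr φ.toEquiv
  rw [Nat.card_eq_fintype_card (α := Fin m), Fintype.card_fin] at h1
  exact hm.trans h1.ge

theorem IsCycleGraph.ncard_edgeSet (hC : C.IsCycleGraph) : C.edgeSet.ncard = C.verts.ncard := by
  obtain ⟨m, hm, ⟨φ⟩⟩ := hC
  obtain ⟨m, rfl⟩ := Nat.exists_eq_add_of_le' hm
  have h1 : Nat.card C.verts = m + 3 := by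
    rw [Nat.card_congr φ.toEquiv, Nat.card_eq_fintype_card, Fintype.card_fin]
  have h2 := sum_degrees_eq_twice_card_edges (cycleGraph (m + 3))
  simp_rw [cycleGraph_degree_three_le] at h2
  have h3 : C.edgeSet = Sym2.map Subtype.val '' C.coe.edgeSet := by
    ext e
    induction e using Sym2.ind with
    | _ a b =>
      constructor
      · intro h
        exact ⟨s(⟨a, C.edge_vert h⟩, ⟨b, C.edge_vert (C.adj_symm h)⟩), h, rfl⟩
      · rintro ⟨e, he, h⟩
        rw [← h]
        induction e using Sym2.ind with
        | _ x y => exact he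
  rw [h3, Set.ncard_image_of_injective _ (Sym2.map.injective Subtype.val_injective)]
  change Nat.card C.coe.edgeSet = Nat.card C.verts
  rw [h1, Nat.card_congr φ.mapEdgeSet, Nat.card_eq_fintype_card, ← edgeFinset_card]
  simp at h2
  omega

theorem IsCycleGraph.isCycles_spanningCoe (hC : C.IsCycleGraph) : C.spanningCoe.IsCycles := by
  rintro v ⟨w, hw⟩
  exact hC.ncard_neighborSet (C.edge_vert hw)

theorem IsCycleGraph.not_isBridge [Finite V] (hC : C.IsCycleGraph) {H : SimpleGraph V}
    (hH : C.spanningCoe ≤ H) {e : Sym2 V} (he : e ∈ C.edgeSet) : ¬ H.IsBridge e := by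
  induction e using Sym2.ind with
  | _ u v =>
    intro h
    exact h.anti hH (hC.isCycles_spanningCoe.reachable_deleteEdges he)

theorem IsCycleGraph.exists_mem_edgeSet (hC : C.IsCycleGraph) : ∃ e, e ∈ C.edgeSet := by
  have h1 := hC.three_le_ncard
  rw [← hC.ncard_edgeSet] at h1
  exact Set.nonempty_of_ncard_ne_zero (by omega)

end Subgraph

namespace IsUnicyclicWith

variable {C : G.Subgraph}

theorem connected_deleteEdges [Finite V] (hC : G.IsUnicyclicWith C) (hconn : G.Connected)
    {e : Sym2 V} (he : e ∈ C.edgeSet) : (G.deleteEdges {e}).Connected := by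
  have := hC.1.not_isBridge C.spanningCoe_le he
  induction e using Sym2.ind with
  | _ u v => exact hconn.connected_delete_edge_of_not_isBridge this

/-- A cycle avoiding `e` would be a cycle of `G`, hence equal to `C`, which contains `e`. -/
theorem isAcyclic_deleteEdges (hC : G.IsUnicyclicWith C)
    {e : Sym2 V} (he : e ∈ C.edgeSet) : (G.deleteEdges {e}).IsAcyclic := by
  intro v p hp
  have hle : G.deleteEdges {e} ≤ G := deleteEdges_le _
  have h1 := hC.2 _ (hp.mapLe hle).isCycleGraph_toSubgraph
  rw [← h1, Walk.mem_edges_toSubgraph, Walk.edges_mapLe_eq_edges] at he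
  have h2 := p.edges_subset_edgeSet he
  rw [edgeSet_deleteEdges] at h2
  exact h2.2 rfl

theorem ncard_edgeSet [Finite V] (hC : G.IsUnicyclicWith C) (hconn : G.Connected) :
    G.edgeSet.ncard = Nat.card V := by
  obtain ⟨e, he⟩ := hC.1.exists_mem_edgeSet
  have h1 := (isTree_iff_connected_and_card.1
    ⟨hC.connected_deleteEdges hconn he, hC.isAcyclic_deleteEdges he⟩).2
  rw [← h1, edgeSet_deleteEdges, Nat.card_coe_set_eq]
  exact (Set.ncard_sdiff_singleton_add_one (C.edgeSet_subset he) (Set.toFinite _)).symm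

end IsUnicyclicWith

end SimpleGraph

/-- An iterated finite difference: by Pascal's rule, each element of `L` lowers the lower index by
one. -/
theorem sum_powerset_neg_one_pow_mul_choose {α : Type*} (L : Finset α) (a i : ℕ) :
    ∑ T ∈ L.powerset, (-1 : ℚ) ^ #T * ((a + (#L - #T)).choose i : ℚ) =
      if #L ≤ i then (a.choose (i - #L) : ℚ) else 0 := by
  classical
  induction L using Finset.induction_on generalizing i with
  | empty => simp
  | insert x L hx ih =>
    rw [sum_powerset_insert hx, ← sum_add_distrib, card_insert_of_notMem hx]
    have h1 : ∀ T ∈ L.powerset, (-1 : ℚ) ^ #T * ((a + (#L + 1 - #T)).choose i : ℚ) +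
        (-1 : ℚ) ^ #(insert x T) * ((a + (#L + 1 - #(insert x T))).choose i : ℚ) =
        if i = 0 then 0 else (-1 : ℚ) ^ #T * ((a + (#L - #T)).choose (i - 1) : ℚ) := by
      intro T hT
      have hTL := card_le_card (mem_powerset.1 hT)
      rw [card_insert_of_notMem fun h => hx (mem_powerset.1 hT h),
        show a + (#L + 1 - #T) = a + (#L - #T) + 1 by omega,
        show #L + 1 - (#T + 1) = #L - #T by omega, pow_succ]
      cases i with
      | zero => simp
      | succ i =>
        rw [Nat.choose_succ_succ]
        push_cast
        simp
        ring
    rw [sum_congr rfl h1]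
    cases i with
    | zero => simp
    | succ i => simp [ih]

/-! ### Signed counts of the subgraphs with a prescribed component. -/

namespace SimpleGraph

variable {V : Type*} {G : SimpleGraph V}

theorem Reachable.of_forall_adj {H H' : SimpleGraph V} (h : ∀ a b, H.Adj a b → H'.Reachable a b)
    {u v : V} (huv : H.Reachable u v) : H'.Reachable u v := by
  obtain ⟨p⟩ := huv
  induction p with
  | nil => exact Reachable.rfl
  | cons hadj p ih => exact (h _ _ hadj).trans ih

theorem Reachable.of_closed {H H' : SimpleGraph V} {K : Set V}
    (h : ∀ a b, H.Adj a b → a ∈ K → b ∈ K ∧ H'.Adj a b) {u v : V} (huv : H.Reachable u v)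
    (hu : u ∈ K) : v ∈ K ∧ H'.Reachable u v := by
  obtain ⟨p⟩ := huv
  induction p with
  | nil => exact ⟨hu, Reachable.rfl⟩
  | cons hadj p ih =>
    obtain ⟨h1, h2⟩ := h _ _ hadj hu
    exact (ih h1).imp_right h2.reachable.trans

/-- Any two vertices of the nonempty set `K` are joined by a path with edges in `S`. -/
def EdgesConnect (S : Finset (Sym2 V)) (K : Finset V) : Prop :=
  K.Nonempty ∧ ∀ u ∈ K, ∀ v ∈ K, (fromEdgeSet (S : Set (Sym2 V))).Reachable u v

/-- `K` is the vertex set of a connected component of the graph with edge set `S`. -/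
def IsComponentSupp (S : Finset (Sym2 V)) (K : Finset V) : Prop :=
  ∃ c : (fromEdgeSet (S : Set (Sym2 V))).ConnectedComponent, c.supp = K

theorem isComponentSupp_iff {S : Finset (Sym2 V)} {K : Finset V} :
    IsComponentSupp S K ↔ EdgesConnect S K ∧ ∀ u v, s(u, v) ∈ S → u ∈ K → v ∈ K := by
  constructor
  · rintro ⟨c, hc⟩
    have hmem : ∀ v, v ∈ K ↔ (fromEdgeSet (S : Set (Sym2 V))).connectedComponentMk v = c := by
      intro v
      rw [← mem_coe, ← hc, ConnectedComponent.mem_supp_iff]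
    refine ⟨⟨?_, ?_⟩, ?_⟩
    · obtain ⟨v, hv⟩ := c.nonempty_supp
      exact ⟨v, (hmem v).2 hv⟩
    · intro u hu v hv
      exact ConnectedComponent.exact (((hmem u).1 hu).trans ((hmem v).1 hv).symm)
    · intro u v huv hu
      by_cases h : u = v
      · exact h ▸ hu
      · rw [hmem, ← (hmem u).1 hu]
        refine ConnectedComponent.sound (Adj.reachable ?_).symm
        rw [fromEdgeSet_adj]
        exact ⟨huv, h⟩
  · rintro ⟨⟨⟨v, hv⟩, hconn⟩, hcl⟩
    refine ⟨connectedComponentMk _ v, ?_⟩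
    ext u
    rw [ConnectedComponent.mem_supp_iff, ConnectedComponent.eq, mem_coe]
    constructor
    · intro h
      refine (h.symm.of_closed (K := (K : Set V)) (fun a b hab ha => ⟨?_, hab⟩) hv).1
      rw [fromEdgeSet_adj] at hab
      exact hcl a b hab.1 ha
    · intro h
      exact hconn u h v hv

theorem EdgesConnect.mono {S T : Finset (Sym2 V)} {K : Finset V} (h : EdgesConnect S K)
    (hST : S ⊆ T) : EdgesConnect T K :=
  ⟨h.1, fun u hu v hv => (h.2 u hu v hv).mono (fromEdgeSet_mono (by exact_mod_cast hST))⟩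

theorem EdgesConnect.card_le [Finite V] {S : Finset (Sym2 V)} {K : Finset V} (h : EdgesConnect S K) :
    #K ≤ #S + 1 := by
  classical
  obtain ⟨v, hv⟩ := h.1
  set H := fromEdgeSet (S : Set (Sym2 V)) with hH
  set c := H.connectedComponentMk v
  have h1 := c.connected_toSimpleGraph.card_vert_le_card_edgeSet_add_one
  have h2 : Nat.card c.toSimpleGraph.edgeSet ≤ #S := by
    rw [Nat.card_coe_set_eq, ← Set.ncard_image_of_injective _
      (Sym2.map.injective Subtype.val_injective), ← Set.ncard_coe_finset]
    refine Set.ncard_le_ncard ?_ S.finite_toSet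
    rintro _ ⟨e, he, rfl⟩
    induction e using Sym2.ind with
    | _ a b =>
      exact ((fromEdgeSet_adj _).1 (show H.Adj a b from he)).1
  have h4 : (K : Set V) ⊆ c.supp := fun u hu =>
    ConnectedComponent.sound (h.2 u hu v hv)
  have h5 := Set.ncard_le_ncard h4 (Set.toFinite _)
  rw [Set.ncard_coe_finset] at h5
  exact h5.trans (h1.trans (Nat.add_le_add_right h2 1))

theorem EdgesConnect.erase [DecidableEq V] [Finite V] {S : Finset (Sym2 V)} {K : Finset V}
    (h : EdgesConnect S K)
    {C : G.Subgraph} (hC : C.IsCycleGraph) (hCS : C.edgeSet ⊆ S) {e : Sym2 V}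
    (he : e ∈ C.edgeSet) : EdgesConnect (S.erase e) K := by
  refine ⟨h.1, fun u hu v hv => (h.2 u hu v hv).of_forall_adj fun a b hab => ?_⟩
  rw [fromEdgeSet_adj] at hab
  by_cases hab' : s(a, b) = e
  · subst hab'
    have hle : C.spanningCoe ≤ fromEdgeSet (S : Set (Sym2 V)) := by
      intro x y hxy
      rw [fromEdgeSet_adj]
      exact ⟨hCS hxy, hxy.ne⟩
    have h1 := hC.not_isBridge hle he
    rw [isBridge_iff, not_not] at h1
    refine h1.mono fun x y hxy => ?_
    rw [deleteEdges_adj, fromEdgeSet_adj] at hxy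
    rw [fromEdgeSet_adj, mem_coe, mem_erase]
    exact ⟨⟨hxy.2, hxy.1.1⟩, hxy.1.2⟩
  · refine Adj.reachable ?_
    rw [fromEdgeSet_adj, mem_coe, mem_erase]
    exact ⟨⟨hab', hab.1⟩, hab.2⟩

/-- A cycle in `S` has a superfluous edge, which improves the bound of `EdgesConnect.card_le` by
one. -/
theorem EdgesConnect.card_le_of_edgeSet_subset [Finite V] {S : Finset (Sym2 V)} {K : Finset V}
    (h : EdgesConnect S K) {C : G.Subgraph} (hC : C.IsCycleGraph) (hCS : C.edgeSet ⊆ S) :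
    #K ≤ #S := by
  classical
  obtain ⟨e, he⟩ := hC.exists_mem_edgeSet
  have h1 := (h.erase hC hCS he).card_le
  rwa [card_erase_add_one (hCS he)] at h1

section Weight

variable [Fintype V] [DecidableEq V] [DecidableRel G.Adj]

variable (G) in
/-- The alternating sum over the spanning subgraphs of `G` having `K` as a component. -/
def componentWeight (K : Finset V) : ℚ :=
  open Classical in ∑ S ∈ G.edgeFinset.powerset, if IsComponentSupp S K then (-1) ^ #S else 0

theorem componentSum_eq_sum_componentWeight (i : ℕ) :
    G.componentSum i = ∑ K : Finset V, ((#K - 1).choose i : ℚ) * G.componentWeight K := by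
  classical
  have h0 : G.componentSum i = ∑ S ∈ G.edgeFinset.powerset, (-1 : ℚ) ^ #S *
      ∑ c : (SimpleGraph.fromEdgeSet (S : Set (Sym2 V))).ConnectedComponent,
      ((c.supp.ncard - 1).choose i : ℚ) := by
    rw [componentSum]
    congr!
  simp_rw [h0, componentWeight, mul_sum]
  rw [sum_comm]
  refine sum_congr rfl fun S _ => ?_
  simp_rw [mul_ite, mul_zero]
  rw [← sum_filter]
  refine sum_bij (fun c _ => c.supp.toFinset) ?_ ?_ ?_ ?_
  · intro c _
    rw [mem_filter]
    exact ⟨mem_univ _, c, by simp⟩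
  · intro c _ c' _ h
    exact ConnectedComponent.supp_injective (by simpa using h)
  · intro K hK
    obtain ⟨c, hc⟩ := (mem_filter.1 hK).2
    exact ⟨c, mem_univ _, by simp [hc]⟩
  · intro c _
    rw [Set.ncard_eq_toFinset_card', mul_comm]

/-- Adding or removing the edge `ab` reverses the sign and does not affect whether `K` is a
component. -/
theorem componentWeight_eq_zero {K : Finset V} {a b : V} (hab : G.Adj a b) (ha : a ∉ K)
    (hb : b ∉ K) : G.componentWeight K = 0 := by
  classical
  have he : s(a, b) ∈ G.edgeFinset := mem_edgeFinset.2 hab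
  rw [componentWeight, ← insert_erase he, sum_powerset_insert (notMem_erase _ _),
    ← sum_add_distrib]
  refine sum_eq_zero fun S hS => ?_
  have hnot : s(a, b) ∉ S := fun h => notMem_erase _ _ (mem_powerset.1 hS h)
  have h1 : IsComponentSupp (insert s(a, b) S) K ↔ IsComponentSupp S K := by
    rw [isComponentSupp_iff, isComponentSupp_iff]
    constructor
    · rintro ⟨⟨hne, hconn⟩, hcl⟩
      refine ⟨⟨hne, fun u hu v hv => ?_⟩, fun u v huv => hcl u v (mem_insert_of_mem huv)⟩
      refine ((hconn u hu v hv).of_closed (K := (K : Set V)) (fun x y hxy hx => ?_) hu).2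
      rw [fromEdgeSet_adj, mem_coe] at hxy
      refine ⟨hcl x y hxy.1 hx, ?_⟩
      rw [fromEdgeSet_adj]
      refine ⟨(mem_insert.1 hxy.1).resolve_left fun h => ?_, hxy.2⟩
      rcases Sym2.eq_iff.1 h with ⟨rfl, rfl⟩ | ⟨rfl, rfl⟩
      · exact ha hx
      · exact hb hx
    · rintro ⟨hconn, hcl⟩
      refine ⟨hconn.mono (subset_insert _ _), fun u v huv hu => ?_⟩
      rcases mem_insert.1 huv with h | h
      · rcases Sym2.eq_iff.1 h with ⟨rfl, rfl⟩ | ⟨rfl, rfl⟩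
        · exact (ha hu).elim
        · exact (hb hu).elim
      · exact hcl u v h hu
  simp_rw [h1, card_insert_of_notMem hnot, pow_succ]
  split_ifs <;> simp

variable (G) in
/-- The edges of `G` with both endpoints in `K`. -/
def edgesWithin (K : Finset V) : Finset (Sym2 V) :=
  G.edgeFinset.filter fun e => ∀ v ∈ e, v ∈ K

/-- If every edge meets `K`, then no edge of `S` may leave `K`, so `S` lies within `K` and only
connectedness remains to be asked. -/
theorem componentWeight_eq {K : Finset V} (hK : ∀ a b, G.Adj a b → a ∉ K → b ∈ K) :
    G.componentWeight K = open Classical in ∑ S ∈ (G.edgesWithin K).powerset,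
      if EdgesConnect S K then (-1) ^ #S else 0 := by
  classical
  rw [componentWeight, ← sum_filter, ← sum_filter]
  refine sum_congr ?_ fun _ _ => rfl
  ext S
  simp only [mem_filter, mem_powerset, isComponentSupp_iff]
  constructor
  · rintro ⟨hS, hconn, hcl⟩
    refine ⟨fun e he => ?_, hconn⟩
    rw [edgesWithin, mem_filter]
    refine ⟨hS he, ?_⟩
    induction e using Sym2.ind with
    | _ a b =>
      have hadj : G.Adj a b := mem_edgeFinset.1 (hS he)
      have ha : a ∈ K := by
        by_contra ha
        exact ha (hcl b a (by rwa [Sym2.eq_swap]) (hK a b hadj ha))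
      have hb := hcl a b he ha
      intro v hv
      rcases Sym2.mem_iff.1 hv with rfl | rfl
      · exact ha
      · exact hb
  · rintro ⟨hS, hconn⟩
    refine ⟨hS.trans (filter_subset _ _), hconn, fun u v huv _ => ?_⟩
    exact (mem_filter.1 (hS huv)).2 v (Sym2.mem_mk_right _ _)

/-- The vertices outside `K` are pairwise non-adjacent, so their sets of incident edges are
disjoint. -/
theorem card_edgesWithin_add {K : Finset V} (hK : ∀ a b, G.Adj a b → a ∉ K → b ∈ K) :
    #(G.edgesWithin K) + ∑ v ∈ Kᶜ, G.degree v = #G.edgeFinset := by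
  rw [← card_filter_add_card_filter_not (s := G.edgeFinset) (p := fun e => ∀ v ∈ e, v ∈ K),
    edgesWithin]
  congr 1
  have h1 : G.edgeFinset.filter (fun e => ¬ ∀ v ∈ e, v ∈ K) = Kᶜ.biUnion fun v => G.incidenceFinset v := by
    ext e
    simp only [mem_filter, mem_biUnion, mem_compl, mem_incidenceFinset, mem_edgeFinset, not_forall,
      incidenceSet]
    constructor
    · rintro ⟨he, v, hv, hvK⟩
      exact ⟨v, hvK, he, hv⟩
    · rintro ⟨v, hvK, he, hv⟩
      exact ⟨he, v, hv, hvK⟩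
  rw [h1, card_biUnion]
  · simp
  · intro u hu v hv huv
    refine Finset.disjoint_left.2 fun e heu hev => ?_
    rw [mem_incidenceFinset] at heu hev
    have : e = s(u, v) := (Sym2.mem_and_mem_iff huv).1 ⟨heu.2, hev.2⟩
    subst this
    exact mem_compl.1 hv (hK u v heu.1 (mem_compl.1 hu))

/-- `G` minus `e` is connected, and dropping vertices with at most one neighbour there keeps it
connected. -/
theorem edgesConnect_erase_edgesWithin {C : G.Subgraph} (hC : G.IsUnicyclicWith C)
    (hconn : G.Connected) {K : Finset V} (hne : K.Nonempty) {e : Sym2 V} (he : e ∈ C.edgeSet)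
    (hK : ∀ v ∉ K, ((G.deleteEdges {e}).neighborSet v).Subsingleton) :
    EdgesConnect ((G.edgesWithin K).erase e) K := by
  have h1 := (hC.connected_deleteEdges hconn he).preconnected.induce_of_degree_eq_one
    (s := (K : Set V)) (fun v hv => hK v hv)
  refine ⟨hne, fun u hu v hv => ?_⟩
  let f : (G.deleteEdges {e}).induce (K : Set V) →g
      fromEdgeSet (((G.edgesWithin K).erase e : Finset (Sym2 V)) : Set (Sym2 V)) :=
    { toFun := Subtype.val
      map_rel' := by
        rintro ⟨a, ha⟩ ⟨b, hb⟩ hab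
        rw [comap_adj, deleteEdges_adj] at hab
        rw [fromEdgeSet_adj, mem_coe, mem_erase, edgesWithin, mem_filter, mem_edgeFinset]
        refine ⟨⟨hab.2, hab.1, ?_⟩, hab.1.ne⟩
        intro v hv
        rcases Sym2.mem_iff.1 hv with rfl | rfl
        · exact ha
        · exact hb }
  exact (h1 ⟨u, hu⟩ ⟨v, hv⟩).map f

end Weight

end SimpleGraph

/-! ### The weights of vertex sets in a unicyclic graph. -/

namespace SimpleGraph.IsUnicyclicWith

variable {V : Type*} {G : SimpleGraph V} {C : G.Subgraph}

theorem exists_mem_verts (hC : G.IsUnicyclicWith C) : ∃ v, v ∈ C.verts := by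
  have := hC.1.three_le_ncard
  exact Set.nonempty_of_ncard_ne_zero (by omega)

variable [Fintype V] [DecidableRel G.Adj]

theorem _root_.SimpleGraph.degree_eq_ncard_neighborSet (v : V) :
    G.degree v = (G.neighborSet v).ncard := by
  rw [← card_neighborSet_eq_degree, ← Nat.card_eq_fintype_card]
  rfl

theorem two_le_degree (hC : G.IsUnicyclicWith C) {v : V} (hv : v ∈ C.verts) : 2 ≤ G.degree v := by
  rw [degree_eq_ncard_neighborSet, ← hC.1.ncard_neighborSet hv]
  exact Set.ncard_le_ncard (C.neighborSet_subset v) (Set.toFinite _)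

theorem adj_of_degree_eq_two (hC : G.IsUnicyclicWith C) {v w : V} (hv : v ∈ C.verts)
    (hdeg : G.degree v = 2) (hvw : G.Adj v w) : C.Adj v w := by
  rw [degree_eq_ncard_neighborSet, ← hC.1.ncard_neighborSet hv] at hdeg
  have := Set.eq_of_subset_of_ncard_le (C.neighborSet_subset v) hdeg.le (Set.toFinite _)
  have h : w ∈ C.neighborSet v := this ▸ hvw
  exact h

theorem one_le_degree (hC : G.IsUnicyclicWith C) (hconn : G.Connected) (v : V) :
    1 ≤ G.degree v := by
  have : Nontrivial V := by
    by_contra h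
    rw [not_nontrivial_iff_subsingleton] at h
    have h3 := hC.1.three_le_ncard
    have := Set.ncard_le_one_of_subsingleton C.verts
    omega
  exact hconn.preconnected.degree_pos_of_nontrivial v

/-- Two adjacent leaves would make up the whole connected graph, leaving no room for the cycle. -/
theorem not_adj_of_degree_eq_one (hC : G.IsUnicyclicWith C) (hconn : G.Connected) {a b : V}
    (ha : G.degree a = 1) (hb : G.degree b = 1) : ¬ G.Adj a b := by
  intro hab
  obtain ⟨a', -, ha'⟩ := degree_eq_one_iff_existsUnique_adj.1 ha
  obtain ⟨b', -, hb'⟩ := degree_eq_one_iff_existsUnique_adj.1 hb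
  obtain ⟨v, hv⟩ := hC.exists_mem_verts
  have h1 := ((hconn.preconnected a v).of_closed (H' := G) (K := {a, b})
    (fun x y hxy hx => ⟨?_, hxy⟩) (Set.mem_insert _ _)).1
  · have h2 := hC.two_le_degree hv
    rcases h1 with rfl | rfl <;> omega
  · rcases hx with rfl | rfl
    · exact Or.inr ((ha' y hxy).trans (ha' b hab).symm)
    · exact Or.inl ((hb' y hxy).trans (hb' a hab.symm).symm)

theorem card_edgeFinset (hC : G.IsUnicyclicWith C) (hconn : G.Connected) :
    #G.edgeFinset = Fintype.card V := by
  rw [← Nat.card_eq_fintype_card, ← hC.ncard_edgeSet hconn, ← Set.ncard_coe_finset, coe_edgeFinset]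

theorem subsingleton_neighborSet_of_degree_eq_one {v : V} (hv : G.degree v = 1) :
    (G.neighborSet v).Subsingleton := by
  rw [degree_eq_ncard_neighborSet] at hv
  exact Set.ncard_le_one_iff_subsingleton.1 hv.le

theorem nontrivial_rootedTree_iff (hC : G.IsUnicyclicWith C) {v : V} (hv : v ∈ C.verts) :
    (C.rootedTree v).Nontrivial ↔ G.degree v ≠ 2 := by
  have h0 : v ∈ C.rootedTree v := Reachable.rfl
  constructor
  · intro h hdeg
    obtain ⟨w, hw, hwv⟩ := h.exists_ne v
    have hw' : (G.deleteEdges C.edgeSet).Reachable v w := hw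
    refine hwv (hw'.of_closed (H' := G) (K := {v}) (fun a b hab ha => ?_) rfl).1
    rw [deleteEdges_adj] at hab
    rw [Set.mem_singleton_iff] at ha
    subst ha
    exact (hab.2 (hC.adj_of_degree_eq_two hv hdeg hab.1)).elim
  · intro h
    have h1 : ∃ w, G.Adj v w ∧ ¬ C.Adj v w := by
      by_contra! h2
      refine h ?_
      rw [degree_eq_ncard_neighborSet, ← hC.1.ncard_neighborSet hv]
      congr 1
      exact Set.Subset.antisymm h2 (C.neighborSet_subset v)
    obtain ⟨w, hw, hw'⟩ := h1
    refine ⟨v, h0, w, Adj.reachable ?_, hw.ne⟩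
    rw [deleteEdges_adj]
    exact ⟨hw, hw'⟩

variable [DecidableEq V]

theorem mem_of_degree_eq_one (hC : G.IsUnicyclicWith C) {K : Finset V}
    (hK : ∀ v ∉ K, G.degree v = 1) {v : V} (hv : v ∈ C.verts) : v ∈ K := by
  by_contra h
  have := hC.two_le_degree hv
  have := hK v h
  omega

theorem mem_or_mem_of_degree_eq_one (hC : G.IsUnicyclicWith C) (hconn : G.Connected) {K : Finset V}
    (hK : ∀ v ∉ K, G.degree v = 1) : ∀ a b, G.Adj a b → a ∉ K → b ∈ K := by
  intro a b hab ha
  by_contra hb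
  exact hC.not_adj_of_degree_eq_one hconn (hK a ha) (hK b hb) hab

theorem card_edgesWithin (hC : G.IsUnicyclicWith C) (hconn : G.Connected) {K : Finset V}
    (hK : ∀ v ∉ K, G.degree v = 1) : #(G.edgesWithin K) = #K := by
  have h1 := card_edgesWithin_add (hC.mem_or_mem_of_degree_eq_one hconn hK)
  rw [hC.card_edgeFinset hconn, sum_congr rfl fun v hv => hK v (mem_compl.1 hv),
    ← card_eq_sum_ones, card_compl] at h1
  have := card_le_univ K
  omega

/-- Removing leaves keeps the numbers of edges and vertices equal, so `K` again spans a connected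
unicyclic graph. Its connected spanning subgraphs are the whole graph and the `c` subgraphs missing
one cycle edge; the signs are opposite. -/
theorem componentWeight_of_leaves (hC : G.IsUnicyclicWith C) (hconn : G.Connected) {K : Finset V}
    (hK : ∀ v ∉ K, G.degree v = 1) :
    G.componentWeight K = ((C.verts.ncard : ℚ) - 1) * (-1) ^ (#K - 1) := by
  classical
  have hcard := hC.card_edgesWithin hconn hK
  have hne : K.Nonempty := by
    obtain ⟨v, hv⟩ := hC.exists_mem_verts
    exact ⟨v, hC.mem_of_degree_eq_one hK hv⟩
  have hsub : C.edgeSet.toFinset ⊆ G.edgesWithin K := by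
    intro e he
    rw [Set.mem_toFinset] at he
    rw [edgesWithin, mem_filter, mem_edgeFinset]
    exact ⟨C.edgeSet_subset he, fun v hv => hC.mem_of_degree_eq_one hK
      (C.mem_verts_of_mem_edge he hv)⟩
  have herase : ∀ e ∈ C.edgeSet, EdgesConnect ((G.edgesWithin K).erase e) K := by
    intro e he
    refine edgesConnect_erase_edgesWithin hC hconn hne he fun v hv => ?_
    exact (subsingleton_neighborSet_of_degree_eq_one (hK v hv)).anti
      fun w hw => (deleteEdges_le (G := G) {e}) hw
  have hfilter : {S ∈ (G.edgesWithin K).powerset | EdgesConnect S K} =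
      insert (G.edgesWithin K) (C.edgeSet.toFinset.image (G.edgesWithin K).erase) := by
    ext S
    simp only [mem_filter, mem_powerset, mem_insert, mem_image, Set.mem_toFinset]
    constructor
    · rintro ⟨hS, hSconn⟩
      by_cases hSE : S = G.edgesWithin K
      · exact Or.inl hSE
      right
      have h1 := hSconn.card_le
      have h2 := card_lt_card (hS.ssubset_of_ne hSE)
      have h3 : #(G.edgesWithin K \ S) = 1 := by
        rw [card_sdiff_of_subset hS]
        omega
      obtain ⟨e, he⟩ := card_eq_one.1 h3
      have hSe : (G.edgesWithin K).erase e = S := by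
        rw [← sdiff_singleton_eq_erase, ← he, Finset.sdiff_sdiff_eq_self hS]
      refine ⟨e, ?_, hSe⟩
      by_contra heC
      have := hSconn.card_le_of_edgeSet_subset hC.1 fun e' he' => by
        rw [← hSe, mem_coe, mem_erase]
        exact ⟨fun h => heC (h ▸ he'), hsub (Set.mem_toFinset.2 he')⟩
      omega
    · rintro (rfl | ⟨e, he, rfl⟩)
      · obtain ⟨e, he⟩ := hC.1.exists_mem_edgeSet
        exact ⟨Subset.rfl, (herase e he).mono (erase_subset _ _)⟩
      · exact ⟨erase_subset _ _, herase e he⟩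
  rw [componentWeight_eq (hC.mem_or_mem_of_degree_eq_one hconn hK), ← sum_filter, hfilter,
    sum_insert, sum_image]
  · have h1 : ∀ e ∈ C.edgeSet.toFinset, (-1 : ℚ) ^ #((G.edgesWithin K).erase e) =
        (-1) ^ (#K - 1) := by
      intro e he
      rw [card_erase_of_mem (hsub he), hcard]
    rw [sum_congr rfl h1, sum_const, ← Set.ncard_eq_toFinset_card', hC.1.ncard_edgeSet, hcard]
    obtain ⟨m, hm⟩ := Nat.exists_eq_succ_of_ne_zero hne.card_ne_zero
    rw [hm, Nat.succ_sub_one, pow_succ, nsmul_eq_mul]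
    ring
  · intro e he e' he' h
    exact erase_injOn _ (hsub he) (hsub he') h
  · rw [mem_image]
    rintro ⟨e, he, h⟩
    exact erase_eq_self.1 h (hsub he)

/-- Removing `v` breaks the cycle and costs two edges, so `K` spans a tree, whose only connected
spanning subgraph is itself. -/
theorem componentWeight_of_cycle_vertex (hC : G.IsUnicyclicWith C) (hconn : G.Connected)
    {K : Finset V} {v : V} (hv : v ∈ C.verts) (hvK : v ∉ K) (hdeg : G.degree v = 2)
    (hK : ∀ u ∉ K, u ≠ v → G.degree u = 1) :
    G.componentWeight K = (-1) ^ (#K - 1) := by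
  classical
  have hmem : ∀ w ∈ C.verts, w ≠ v → w ∈ K := by
    intro w hw hwv
    by_contra h
    have := hC.two_le_degree hw
    have := hK w h hwv
    omega
  have hmem' : ∀ w, G.Adj v w → w ∈ K := fun w hvw =>
    hmem w (C.edge_vert (hC.adj_of_degree_eq_two hv hdeg hvw).symm) hvw.ne'
  have hcov : ∀ a b, G.Adj a b → a ∉ K → b ∈ K := by
    intro a b hab ha
    by_cases hav : a = v
    · exact hmem' b (hav ▸ hab)
    · by_contra hb
      by_cases hbv : b = v
      · exact ha (hmem' a (hbv ▸ hab.symm))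
      · exact hC.not_adj_of_degree_eq_one hconn (hK a ha hav) (hK b hb hbv) hab
  have hcard : #(G.edgesWithin K) + 1 = #K := by
    have h1 := card_edgesWithin_add hcov
    have hvc : v ∈ Kᶜ := mem_compl.2 hvK
    rw [hC.card_edgeFinset hconn, ← add_sum_erase _ _ hvc, hdeg,
      sum_congr rfl fun u hu => hK u (mem_compl.1 (mem_erase.1 hu).2) (mem_erase.1 hu).1,
      ← card_eq_sum_ones, card_erase_of_mem hvc, card_compl] at h1
    have := card_lt_univ_of_notMem hvK
    omega
  obtain ⟨w, hw⟩ : (C.neighborSet v).Nonempty :=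
    Set.nonempty_of_ncard_ne_zero (by rw [hC.1.ncard_neighborSet hv]; omega)
  have hwK : w ∈ K := hmem' w hw.adj_sub
  have hnot : s(v, w) ∉ G.edgesWithin K := fun h =>
    hvK ((mem_filter.1 h).2 v (Sym2.mem_mk_left _ _))
  have hE : EdgesConnect (G.edgesWithin K) K := by
    rw [← erase_eq_of_notMem hnot]
    refine edgesConnect_erase_edgesWithin hC hconn ⟨w, hwK⟩ hw fun u hu => ?_
    by_cases huv : u = v
    · subst huv
      -- Once one of its two cycle edges is deleted, this vertex is a leaf.
      have h1 : (G.deleteEdges {s(u, w)}).neighborSet u ⊆ G.neighborSet u \ {w} := by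
        intro x hx
        rw [mem_neighborSet, deleteEdges_adj] at hx
        exact ⟨hx.1, fun h => hx.2 (by rw [Set.mem_singleton_iff.1 h]; rfl)⟩
      refine Set.Subsingleton.anti ?_ h1
      rw [← Set.ncard_le_one_iff_subsingleton,
        Set.ncard_sdiff_singleton_of_mem (by exact hw.adj_sub), ← degree_eq_ncard_neighborSet, hdeg]
    · exact (subsingleton_neighborSet_of_degree_eq_one (hK u hu huv)).anti
        fun x hx => (deleteEdges_le (G := G) {s(v, w)}) hx
  rw [componentWeight_eq hcov, sum_eq_single (G.edgesWithin K), if_pos hE, ← hcard,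
    Nat.add_sub_cancel]
  · intro S hS hne
    rw [if_neg]
    intro h
    have h1 := h.card_le
    have h2 := card_lt_card ((mem_powerset.1 hS).ssubset_of_ne hne)
    omega
  · exact fun h => (h (mem_powerset.2 Subset.rfl)).elim

/-- Edge counting gives `∑_{v∉K} (deg v - 1) ≤ 1`, so exactly one missing vertex is not a leaf, and
it has degree 2. Were it off the cycle, the cycle would lie within `K`, and connecting `K` would
take `|K|` edges where only `|K| - 1` are available. -/
theorem exists_cycle_vertex_of_componentWeight_ne_zero (hC : G.IsUnicyclicWith C)
    (hconn : G.Connected) {K : Finset V} (hW : G.componentWeight K ≠ 0)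
    (hK : ¬ ∀ v ∉ K, G.degree v = 1) :
    ∃ v ∈ C.verts, v ∉ K ∧ G.degree v = 2 ∧ ∀ u ∉ K, u ≠ v → G.degree u = 1 := by
  classical
  have hcov : ∀ a b, G.Adj a b → a ∉ K → b ∈ K := by
    intro a b hab ha
    by_contra hb
    exact hW (componentWeight_eq_zero hab ha hb)
  rw [componentWeight_eq hcov] at hW
  obtain ⟨S, hS, hSW⟩ := exists_ne_zero_of_sum_ne_zero hW
  have hE : EdgesConnect (G.edgesWithin K) K := by
    by_contra h
    exact hSW (if_neg fun h' => h (h'.mono (mem_powerset.1 hS)))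
  push Not at hK
  obtain ⟨v, hvK, hv⟩ := hK
  have hvc : v ∈ Kᶜ := mem_compl.2 hvK
  have h1 := card_edgesWithin_add hcov
  have h2 := hE.card_le
  have hlt := card_lt_univ_of_notMem hvK
  have hdeg : ∀ u, 1 ≤ G.degree u := hC.one_le_degree hconn
  rw [hC.card_edgeFinset hconn, ← add_sum_erase _ _ hvc] at h1
  have h3 : ∀ T : Finset V, #T ≤ ∑ u ∈ T, G.degree u := by
    intro T
    rw [card_eq_sum_ones]
    exact sum_le_sum fun u _ => hdeg u
  have h4 := h3 (Kᶜ.erase v)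
  have h5 := hdeg v
  have h6 : #(Kᶜ.erase v) + 1 + #K = Fintype.card V := by
    rw [card_erase_add_one hvc, card_compl]
    omega
  have hother : ∀ u ∉ K, u ≠ v → G.degree u = 1 := by
    intro u hu huv
    have huc : u ∈ Kᶜ.erase v := mem_erase.2 ⟨huv, mem_compl.2 hu⟩
    have h7 := h3 ((Kᶜ.erase v).erase u)
    rw [← add_sum_erase _ _ huc] at h1
    have h8 := card_erase_add_one huc
    have := hdeg u
    omega
  refine ⟨v, ?_, hvK, by omega, hother⟩
  by_contra hvC
  have h9 : C.edgeSet ⊆ G.edgesWithin K := by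
    intro e he
    rw [mem_coe, edgesWithin, mem_filter, mem_edgeFinset]
    refine ⟨C.edgeSet_subset he, fun x hx => ?_⟩
    have hxC := C.mem_verts_of_mem_edge he hx
    by_contra hxK
    have := hC.two_le_degree hxC
    have := hother x hxK fun h => hvC (h ▸ hxC)
    omega
  have h10 := hE.card_le_of_edgeSet_subset hC.1 h9
  omega

end SimpleGraph.IsUnicyclicWith

/-! ### Summing over sets of leaves, and the final formula. -/

namespace SimpleGraph.IsUnicyclicWith

variable {V : Type*} [Fintype V] {G : SimpleGraph V} [DecidableRel G.Adj] {C : G.Subgraph}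

variable (G) in
/-- The vertices of degree one. -/
def _root_.SimpleGraph.leaves : Finset V := univ.filter fun v => G.degree v = 1

/-- The internal edges are those within the set of non-leaves, which spans as many edges as it has
vertices. -/
theorem ncard_internalEdges (hC : G.IsUnicyclicWith C) (hconn : G.Connected) :
    G.internalEdges.ncard + #G.leaves = Fintype.card V := by
  classical
  have hK : ∀ v ∉ G.leavesᶜ, G.degree v = 1 := by simp [leaves]
  have h1 : G.internalEdges = G.edgesWithin G.leavesᶜ := by
    ext e
    simp only [internalEdges, edgesWithin, leaves, Set.mem_ofPred_eq, coe_filter, mem_edgeFinset,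
      mem_compl, mem_filter, mem_univ, true_and]
    refine and_congr_right fun _ => forall₂_congr fun v _ => ?_
    have := hC.one_le_degree hconn v
    omega
  rw [h1, Set.ncard_coe_finset, hC.card_edgesWithin hconn hK, card_compl]
  have := card_le_univ G.leaves
  omega

theorem three_le_ncard_internalEdges (hC : G.IsUnicyclicWith C) :
    3 ≤ G.internalEdges.ncard := by
  refine hC.1.three_le_ncard.trans ?_
  rw [← hC.1.ncard_edgeSet]
  refine Set.ncard_le_ncard (fun e he => ⟨C.edgeSet_subset he, fun v hv => ?_⟩) (Set.toFinite _)
  exact hC.two_le_degree (C.mem_verts_of_mem_edge he hv)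

theorem ncard_degree_eq_two (hC : G.IsUnicyclicWith C) :
    {v | v ∈ C.verts ∧ G.degree v = 2}.ncard + C.numNontrivialTrees = C.verts.ncard := by
  rw [Subgraph.numNontrivialTrees, ← Set.ncard_union_eq _ (Set.toFinite _) (Set.toFinite _)]
  · congr 1
    ext v
    simp only [Set.mem_union, Set.mem_ofPred_eq]
    constructor
    · rintro (h | h) <;> exact h.1
    · intro h
      by_cases h2 : G.degree v = 2
      · exact Or.inl ⟨h, h2⟩
      · exact Or.inr ⟨h, (hC.nontrivial_rootedTree_iff h).2 h2⟩
  · rw [Set.disjoint_left]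
    rintro v ⟨hv, h2⟩ ⟨-, h3⟩
    exact (hC.nontrivial_rootedTree_iff hv).1 h3 h2

/-- Indexed by the complement of `K`: a set `L` of leaves, or such an `L` together with one of the
`c - r` cycle vertices of degree 2. -/
theorem componentSum_eq (hC : G.IsUnicyclicWith C) (hconn : G.Connected) (i : ℕ) :
    G.componentSum i = ((C.verts.ncard : ℚ) - 1) *
      (∑ L ∈ G.leaves.powerset, ((Fintype.card V - #L - 1).choose i : ℚ) *
        (-1) ^ (Fintype.card V - #L - 1)) +
      ((C.verts.ncard : ℚ) - C.numNontrivialTrees) *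
      ∑ L ∈ G.leaves.powerset, ((Fintype.card V - #L - 2).choose i : ℚ) *
        (-1) ^ (Fintype.card V - #L - 2) := by
  classical
  set T : Finset V := univ.filter fun v => v ∈ C.verts ∧ G.degree v = 2 with hT
  have hTcard : (#T : ℚ) = (C.verts.ncard : ℚ) - C.numNontrivialTrees := by
    rw [← hC.ncard_degree_eq_two, ← Set.ncard_coe_finset, hT]
    push_cast
    simp
  have hTL : ∀ v ∈ T, ∀ L ⊆ G.leaves, v ∉ L := by
    intro v hv L hL h
    have h1 := (mem_filter.1 (hL h)).2
    have h2 := (mem_filter.1 hv).2.2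
    omega
  have hsum : G.componentSum i =
      ∑ D : Finset V, ((Fintype.card V - #D - 1).choose i : ℚ) * G.componentWeight Dᶜ := by
    rw [componentSum_eq_sum_componentWeight]
    refine Fintype.sum_equiv (Equiv.ofBijective _ compl_bijective) _ _ fun K => ?_
    have := card_le_univ K
    simp only [Equiv.ofBijective_apply, compl_compl, card_compl]
    rw [show Fintype.card V - (Fintype.card V - #K) = #K by omega]
  rw [hsum, ← sum_filter_add_sum_filter_not univ (· ∈ G.leaves.powerset)]
  congr 1
  · rw [filter_mem_eq_inter, univ_inter, mul_sum]
    refine sum_congr rfl fun L hL => ?_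
    rw [hC.componentWeight_of_leaves hconn (K := Lᶜ), card_compl]
    · ring
    · intro v hv
      rw [mem_compl, not_not] at hv
      exact (mem_filter.1 (mem_powerset.1 hL hv)).2
  · rw [← hTcard, ← nsmul_eq_mul, ← sum_const, ← sum_product' T G.leaves.powerset
      fun _ L => ((Fintype.card V - #L - 2).choose i : ℚ) * (-1) ^ (Fintype.card V - #L - 2)]
    symm
    refine sum_of_injOn (fun p => insert p.1 p.2) ?_ ?_ ?_ ?_
    · rintro ⟨v, L⟩ hp ⟨v', L'⟩ hp' h
      simp only [coe_product, Set.mem_prod, mem_coe, mem_powerset] at hp hp' h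
      have hv : v = v' := by
        by_contra hne
        have h1 : v ∈ insert v' L' := h ▸ mem_insert_self v L
        exact hTL v hp.1 L' hp'.2 ((mem_insert.1 h1).resolve_left hne)
      subst hv
      rw [← erase_insert (hTL v hp.1 L hp.2), h, erase_insert (hTL v hp.1 L' hp'.2)]
    · rintro ⟨v, L⟩ hp
      simp only [coe_product, Set.mem_prod, mem_coe, mem_powerset] at hp
      rw [mem_coe, mem_filter, mem_powerset]
      exact ⟨mem_univ _, fun h => hTL v hp.1 _ h (mem_insert_self v L)⟩
    · intro D hD hD'
      have hD2 := (mem_filter.1 hD).2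
      by_contra hne
      have hW := right_ne_zero_of_mul hne
      obtain ⟨v, hvC, hvD, hv2, hvo⟩ := hC.exists_cycle_vertex_of_componentWeight_ne_zero hconn hW
        fun h => hD2 (mem_powerset.2 fun v hv => mem_filter.2 ⟨mem_univ _, h v (by simpa using hv)⟩)
      refine hD' ⟨(v, D.erase v), ?_, insert_erase (by simpa using hvD)⟩
      simp only [coe_product, Set.mem_prod, mem_coe, mem_powerset]
      refine ⟨mem_filter.2 ⟨mem_univ _, hvC, hv2⟩, fun u hu => ?_⟩
      rw [mem_erase] at hu
      exact mem_filter.2 ⟨mem_univ _, hvo u (by simpa using hu.2) hu.1⟩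
    · rintro ⟨v, L⟩ hp
      simp only [mem_product, mem_powerset] at hp
      have hvT := (mem_filter.1 hp.1).2
      simp only
      rw [hC.componentWeight_of_cycle_vertex hconn (K := (insert v L)ᶜ) hvT.1 (by simp) hvT.2,
        card_compl, card_insert_of_notMem (hTL v hp.1 L hp.2)]
      · rw [show Fintype.card V - (#L + 1) - 1 = Fintype.card V - #L - 2 by omega]
      · intro u hu huv
        rw [mem_compl, not_not, mem_insert] at hu
        exact (mem_filter.1 (hp.2 (hu.resolve_left huv))).2

theorem componentSum_eq_choose (hC : G.IsUnicyclicWith C) (hconn : G.Connected) {i m k : ℕ}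
    (hi : i + 1 + m = Fintype.card V) (hk : G.internalEdges.ncard = k) :
    (-1) ^ i * G.componentSum i = (-1) ^ m * (((C.numNontrivialTrees : ℚ) - 1) *
      binomZ (k - 2) ((m : ℤ) - 1) + ((C.verts.ncard : ℚ) - 1) * binomZ (k - 2) m) := by
  have hkl := hC.ncard_internalEdges hconn
  have hk3 := hC.three_le_ncard_internalEdges
  rw [hk] at hkl hk3
  obtain ⟨a, rfl⟩ := Nat.exists_eq_add_of_le' (by omega : 2 ≤ k)
  -- The two sums of `componentSum_eq` are the cases `j = 1` and `j = 2`. Here `a = k - 2`, so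
  -- `Fintype.card V - #G.leaves - j = a + 2 - j`.
  have key : ∀ j ≤ 2, 1 ≤ j → ∑ L ∈ G.leaves.powerset, ((Fintype.card V - #L - j).choose i : ℚ) *
      (-1) ^ (Fintype.card V - #L - j) = (-1) ^ (Fintype.card V - j) *
        if #G.leaves ≤ i then ((a + 2 - j).choose (i - #G.leaves) : ℚ) else 0 := by
    intro j hj hj1
    rw [← sum_powerset_neg_one_pow_mul_choose, mul_sum]
    refine sum_congr rfl fun L hL => ?_
    have h1 := card_le_card (mem_powerset.1 hL)
    rw [show Fintype.card V - #L - j = a + 2 - j + (#G.leaves - #L) by omega,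
      show Fintype.card V - j = a + 2 - j + (#G.leaves - #L) + #L by omega,
      pow_add _ (a + 2 - j + (#G.leaves - #L)) #L]
    have h2 : ((-1 : ℚ) ^ #L) * (-1) ^ #L = 1 := by rw [← mul_pow]; simp
    linear_combination (-((a + 2 - j + (#G.leaves - #L)).choose i : ℚ) *
      (-1) ^ (a + 2 - j + (#G.leaves - #L))) * h2
  rw [hC.componentSum_eq hconn, key 1 (by omega) le_rfl, key 2 le_rfl (by omega)]
  rw [show a + 2 - 1 = a + 1 by omega, Nat.add_sub_cancel]
  have hsign1 : (-1 : ℚ) ^ i * (-1) ^ (Fintype.card V - 1) = (-1) ^ m := by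
    rw [← hi, show i + 1 + m - 1 = i + m by omega, pow_add, ← mul_assoc, ← mul_pow]
    simp
  have hsign2 : (-1 : ℚ) ^ (Fintype.card V - 1) = - (-1) ^ (Fintype.card V - 2) := by
    rw [show Fintype.card V - 1 = Fintype.card V - 2 + 1 by omega, pow_succ]
    ring
  have hb0 : ∀ x : ℕ, binomZ a x = (a.choose x : ℚ) := fun x => by simp [binomZ]
  have hchoose : (if #G.leaves ≤ i then (a.choose (i - #G.leaves) : ℚ) else 0) =
      binomZ a ((m : ℤ) - 1) := by
    -- As `i - #G.leaves = a + 1 - m`, the symmetry of binomial coefficients applies, except at `m =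
    -- 0`, where both sides vanish.
    rcases m with _ | m
    · rw [if_pos (by omega), Nat.choose_eq_zero_of_lt (by omega)]
      simp [binomZ]
    · rw [Nat.cast_succ, add_sub_cancel_right, hb0]
      split_ifs
      · rw [← Nat.choose_symm_of_eq_add (show a = i - #G.leaves + m by omega)]
      · rw [Nat.choose_eq_zero_of_lt (by omega), Nat.cast_zero]
  have hchoose1 : (if #G.leaves ≤ i then ((a + 1).choose (i - #G.leaves) : ℚ) else 0) =
      binomZ a ((m : ℤ) - 1) + binomZ a m := by
    have h1 : (if #G.leaves ≤ i then ((a + 1).choose (i - #G.leaves) : ℚ) else 0) =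
        ((a + 1).choose m : ℚ) := by
      split_ifs
      · rw [← Nat.choose_symm_of_eq_add (show a + 1 = i - #G.leaves + m by omega)]
      · rw [Nat.choose_eq_zero_of_lt (by omega), Nat.cast_zero]
    rw [h1, hb0]
    rcases m with _ | m
    · simp [binomZ]
    · rw [Nat.cast_succ, add_sub_cancel_right, hb0, Nat.choose_succ_succ, Nat.cast_add]
  rw [hchoose, hchoose1]
  rw [hsign2] at hsign1 ⊢
  linear_combination ((C.verts.ncard - 1 : ℚ) * (binomZ a ((m : ℤ) - 1) + binomZ a m) -
    ((C.verts.ncard : ℚ) - C.numNontrivialTrees) * binomZ a ((m : ℤ) - 1)) * hsign1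

end SimpleGraph.IsUnicyclicWith

theorem mainTheorem1 {V : Type*} [Fintype V] (G : SimpleGraph V) [DecidableRel G.Adj]
    (C : G.Subgraph) (n c k r : ℕ)
    (hconn : G.Connected) (hC : G.IsUnicyclicWith C)
    (hn : Fintype.card V = n) (hc : C.verts.ncard = c)
    (hk : G.internalEdges.ncard = k) (hr : C.numNontrivialTrees = r) :
    (∃! a : n.Partition → ℚ, G.chromaticSymm = ∑ lam : n.Partition, a lam • starSymmPart lam) ∧
    ∀ a : n.Partition → ℚ, G.chromaticSymm = ∑ lam : n.Partition, a lam • starSymmPart lam →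
      ∀ (lam : n.Partition) (m₁ : ℕ), lam.IsHook → lam.parts.count 1 = m₁ →
        a lam = (-1) ^ m₁ *
          (((r : ℚ) - 1) * binomZ (k - 2) ((m₁ : ℤ) - 1) +
            ((c : ℚ) - 1) * binomZ (k - 2) (m₁ : ℤ)) := by
  subst hc hr
  have hk3 := hC.three_le_ncard_internalEdges
  have hkn := hC.ncard_internalEdges hconn
  have hbot : G ≠ ⊥ := by
    rintro rfl
    obtain ⟨e, he⟩ := hC.1.exists_mem_edgeSet
    have := C.edgeSet_subset he
    simp at this
  obtain ⟨h1, h2⟩ := star_expansion_hook G hn hbot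
  refine ⟨h1, fun a ha lam m₁ hlam hm => ?_⟩
  obtain ⟨m, hm'⟩ := hlam
  obtain ⟨h3, h4⟩ := h2 a ha lam
  have hlt : m < n := by
    have : 0 < n - m := lam.parts_pos (hm' ▸ Multiset.mem_cons_self _ _)
    omega
  obtain ⟨i, hi⟩ := Nat.exists_eq_add_of_lt hlt
  rw [show n - m = i + 1 by omega] at hm'
  -- For `i = 0` the partition is `(1^n)`: the first part is itself a 1, so `m₁ = n` rather than
  -- `m`. The coefficient is zero and both binomials vanish, because `k - 2 < n - 1`.
  rcases eq_or_ne i 0 with rfl | hi0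
  · have hrep : lam.parts = Multiset.replicate n 1 := by
      rw [hm', hi, add_zero, Multiset.replicate_succ]
    rw [h3 hrep]
    rw [hrep, Multiset.count_replicate_self] at hm
    subst hm
    have hb : ∀ z : ℤ, (n : ℤ) - 1 ≤ z → binomZ (k - 2) z = 0 := by
      intro z hz
      rw [binomZ, if_pos (by omega), Nat.choose_eq_zero_of_lt (by omega), Nat.cast_zero]
    rw [hb _ le_rfl, hb _ (by omega)]
    simp
  · have hm1 : m₁ = m := by
      rw [← hm, hm', Multiset.count_cons_of_ne (by omega), Multiset.count_replicate_self]
    subst hm1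
    rw [h4 i hi0 (by rw [hm', show n - (i + 1) = m₁ by omega])]
    exact hC.componentSum_eq_choose hconn (by omega) hk
end
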